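/- **Setting.** Let $P\subset\mathbb C$ and $V\subset\mathbb C^{n}$, $n\ge 1$, be non-empty connected open sets. All functions below are holomorphic on $P\times V$ (arguments $p$, $v=(v_1,\dots,v_n)$) or on $\{(p_1,p_2,v)\in P\times P\times V: p_1\ne p_2\}$; the argument $v$ is often omitted, $'$ is $\partial/\partial p$, indices denote partial derivatives, and $g(p)=\sum_l g_l(p,v)\,\partial/\partial v_l$. *Enhanced local GT structure* $(g,f,\lambda)$: for pairwise distinct $p_1,p_2,p_3\in P$, $$[g(p_1),g(p_2)]=f(p_2,p_1)g'(p_1)-f(p_1,p_2)g'(p_2)+2f(p_2,p_1)_{p_1}g(p_1)-2f(p_1,p_2)_{p_2}g(p_2),$$ $$g(p_2)(f(p_1,p_3))-g(p_1)(f(p_2,p_3))=f(p_1,p_2)f(p_2,p_3)_{p_2}-f(p_2,p_1)f(p_1,p_3)_{p_1}+f(p_1,p_3)f(p_2,p_3)_{p_3}-f(p_2,p_3)f(p_1,p_3)_{p_3}+2f(p_2,p_3)f(p_1,p_2)_{p_2}-2f(p_1,p_3)f(p_2,p_1)_{p_1},$$ $$g(p_1)(\lambda(p_2,p_3))=\lambda(p_1,p_3)\lambda(p_2,p_1)_{p_1}-\lambda(p_2,p_3)f(p_1,p_2)_{p_2}-f(p_1,p_2)\lambda(p_2,p_3)_{p_2}-f(p_1,p_3)\lambda(p_2,p_3)_{p_3},$$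 and both $f(p_1,p_2)$ and $\lambda(p_1,p_2)$ equal $\frac1{p_1-p_2}+O(1)$, i.e. they have a simple pole with residue $1$ along the diagonal. We call it *admissible* if $g_1$ has no zeros on $P\times V$. Its *space of potentials* $\mathcal P(g,f,\lambda)$ is the space of all holomorphic solutions $h(p,v)$ on $P\times V$ of $$g(p_1)(h(p_2))=\lambda(p_1,p_2)h'(p_1)-f(p_1,p_2)h'(p_2)\qquad(p_1\neq p_2).$$ *Gibbons–Tsarev system* $S=(\hat f,\hat g,q)$, $\hat g_1=1$: the system, for functions $p_1,\dots,p_M,v_1,\dots,v_n$ of $r_1,\dots,r_M$ (all $M$; $\partial_i=\partial/\partial r_i$), $$\partial_ip_j=\hat f(p_i,p_j,v)\,\partial_iv_1\ (i\ne j),\quad \partial_iv_l=\hat g_l(p_i,v)\,\partial_iv_1,\quad \partial_i\partial_jv_1=q(p_i,p_j,v)\,\partial_iv_1\partial_jv_1\ (i\neq j),$$ which is compatible (mixed derivatives, computed by virtue of the system, agree identically in $p$, $v$, $\partial_iv_1$) and non-degenerate ($\hat f$ has a pole of order exactly one along the diagonal). The system *associated* with an admissible $(g,f,\lambda)$ is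 $S_{g,f}$ with $$\hat f=\frac{f(p_1,p_2)}{g_1(p_1)},\qquad \hat g_l=\frac{g_l}{g_1},\qquad q=\frac{2f(p_1,p_2)_{p_2}}{g_1(p_1)}+\frac{\big(f(p_1,p_2)\frac{\partial}{\partial p_2}+g(p_1)\big)(g_1(p_2))}{g_1(p_1)g_1(p_2)}.$$ *Whitham type hierarchy*: a set $H$ of holomorphic functions $h(z,v)$ (potentials) on $P\times V$, one time $t_h$ for each $h\in H$; its equations are the compatibility conditions of $\partial\psi/\partial t_h=h(z,v)$, i.e. for all $h_1,h_2,h_3\in H$ and $z\in P$ $$\sum_l\Big((h_1'h_{2,v_l}-h_2'h_{1,v_l})\frac{\partial v_l}{\partial t_{h_3}}+(h_2'h_{3,v_l}-h_3'h_{2,v_l})\frac{\partial v_l}{\partial t_{h_1}}+(h_3'h_{1,v_l}-h_1'h_{3,v_l})\frac{\partial v_l}{\partial t_{h_2}}\Big)=0 .$$ $H$ is *integrable by hydrodynamic reductions by means of $S$* if for every $M$, by virtue of $S$: (i) $v(r(t))$ satisfies these equations whenever $\partial r_k/\partial t_h=h'(p_k)\rho_k$, with arbitrary $\rho_k$; (ii)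 the diagonal systems $\frac{\partial r_k}{\partial t_h}=\frac{h'(p_k)}{h_0'(p_k)}\frac{\partial r_k}{\partial t_{h_0}}$, $h\in H$, commute: for $\mu_h^k=h'(p_k)/h_0'(p_k)$ and $k\neq l$, the quotient $\partial_l\mu_h^k/(\mu_h^l-\mu_h^k)$ does not depend on $h$ (understood with denominators cleared, where $h_0'(p_k),h_0'(p_l)\ne0$). $H$ is *integrable by hydrodynamic reductions* if such an $S$ exists. *Maximal* means: not contained in a strictly larger set of potentials with the same property. $H$ is *non-degenerate* if the derivatives $h'$, $h\in H$, have no common zero on $P\times V$ and, for some $v\in V$, there are three $h\in H$ with linearly independent derivatives $h'(\cdot,v)$. $H$ has *simple characteristics* if there is a non-empty open $W\subset P\times V$ such that for $(p,v)\in W$ the vectors $c\in\mathbb C^n$ for which the substitution $\partial v/\partial t_h=h'(p)\,c$ satisfies all the equations above at $v$, for all $z\in P$, form at most a line (no two of them are linearly independent). **Proposition 6.2.** There is a one-to-one correspondence between integrable Whitham type hierarchies and enhanced local GT structures, under which the space of potentials of a hierarchy is the space of solutions of the functional equation for $h$. Precisely: 1. For each admissible enhanced local GT structure $(g,f,\lambda)$,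 every set $H\subset\mathcal P(g,f,\lambda)$ is a hierarchy integrable by means of $S_{g,f}$; in particular $S_{g,f}$ is a Gibbons–Tsarev system. 2. If a non-degenerate hierarchy $H$ is integrable by means of a Gibbons–Tsarev system $S$, there is exactly one admissible enhanced local GT structure $(g,f,\lambda)$ with $S_{g,f}=S$ and $H\subset\mathcal P(g,f,\lambda)$. 3. $(g,f,\lambda)\mapsto(S_{g,f},\mathcal P(g,f,\lambda))$ is a bijection from the admissible enhanced local GT structures with non-degenerate $\mathcal P(g,f,\lambda)$ onto the pairs $(S,H)$ such that $H$ is non-degenerate and maximal among the hierarchies integrable by means of $S$. 4. $(g,f,\lambda)\mapsto\mathcal P(g,f,\lambda)$ is a bijection from the admissible enhanced local GT structures whose $\mathcal P(g,f,\lambda)$ is non-degenerate with simple characteristics onto the non-degenerate hierarchies with simple characteristics that are maximal among the hierarchies integrable by hydrodynamic reductions. -/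

import Mathlib

/-- Values of the fields `v = (v_0, ..., v_m)` (there is at least one field). -/
abbrev Fields (m : ℕ) : Type := Fin (m + 1) → ℂ

/-- The set of `(p₁, p₂, v)` with `p₁, p₂ ∈ P` distinct and `v ∈ V`. -/
def offDiagonal {m : ℕ} (P : Set ℂ) (V : Set (Fields m)) : Set (ℂ × ℂ × Fields m) :=
  {x | x.1 ∈ P ∧ x.2.1 ∈ P ∧ x.2.2 ∈ V ∧ x.1 ≠ x.2.1}

/-- `φ(p, v)` is a holomorphic function on `P × V`. A function on `P × V` is represented by its
extension by zero, so that equality of representatives is equality of functions on `P × V`. -/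
structure IsHolomorphic {m : ℕ} {F : Type*} [NormedAddCommGroup F] [NormedSpace ℂ F]
    (P : Set ℂ) (V : Set (Fields m)) (φ : ℂ → Fields m → F) : Prop where
  analytic : AnalyticOnNhd ℂ (fun x : ℂ × Fields m => φ x.1 x.2) (P ×ˢ V)
  zero_outside : ∀ p v, ¬ (p ∈ P ∧ v ∈ V) → φ p v = 0

/-- `φ(p₁, p₂, v)` is a holomorphic function on `P × P × V` minus the diagonal `p₁ = p₂`
(again represented by its extension by zero). -/
structure IsHolomorphicOffDiagonal {m : ℕ} (P : Set ℂ) (V : Set (Fields m))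
    (φ : ℂ → ℂ → Fields m → ℂ) : Prop where
  analytic : AnalyticOnNhd ℂ (fun x : ℂ × ℂ × Fields m => φ x.1 x.2.1 x.2.2) (offDiagonal P V)
  zero_outside : ∀ p₁ p₂ v, (p₁, p₂, v) ∉ offDiagonal P V → φ p₁ p₂ v = 0

/-- `φ(p₁, p₂, v) = ρ(p₁, v) / (p₁ - p₂) + O(1)` near the diagonal: the function
`e = (p₁ - p₂) φ` extends holomorphically across the diagonal, with value `ρ` there. -/
def HasDiagonalResidue {m : ℕ} (P : Set ℂ) (V : Set (Fields m))
    (φ : ℂ → ℂ → Fields m → ℂ) (ρ : ℂ → Fields m → ℂ) : Prop :=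
  ∃ e : ℂ → ℂ → Fields m → ℂ,
    AnalyticOnNhd ℂ (fun x : ℂ × ℂ × Fields m => e x.1 x.2.1 x.2.2) (P ×ˢ P ×ˢ V) ∧
    (∀ p₁ ∈ P, ∀ p₂ ∈ P, ∀ v ∈ V, p₁ ≠ p₂ → φ p₁ p₂ v = e p₁ p₂ v / (p₁ - p₂)) ∧
    (∀ p ∈ P, ∀ v ∈ V, e p p v = ρ p v)

/-- The derivative `h'(p) = ∂h/∂p` of a function `h(p, v)`. -/
noncomputable def dp {m : ℕ} {F : Type*} [NormedAddCommGroup F] [NormedSpace ℂ F]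
    (h : ℂ → Fields m → F) (p : ℂ) (v : Fields m) : F :=
  deriv (fun z => h z v) p

/-- The partial derivative of `φ(p₁, p₂, v)` in the first parameter. -/
noncomputable def dp₁ {m : ℕ} (φ : ℂ → ℂ → Fields m → ℂ) (p₁ p₂ : ℂ) (v : Fields m) : ℂ :=
  deriv (fun z => φ z p₂ v) p₁

/-- The partial derivative of `φ(p₁, p₂, v)` in the second parameter. -/
noncomputable def dp₂ {m : ℕ} (φ : ℂ → ℂ → Fields m → ℂ) (p₁ p₂ : ℂ) (v : Fields m) : ℂ :=
  deriv (fun z => φ p₁ z v) p₂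

/-- The derivative `X(φ) = ∑ l, X_l ∂φ/∂v_l` of a function of the fields along a vector field. -/
noncomputable def alongField {m : ℕ} (X : Fields m → Fields m) (φ : Fields m → ℂ)
    (v : Fields m) : ℂ :=
  fderiv ℂ φ v (X v)

/-! Enhanced local GT structures -/

/-- The data of an enhanced local GT structure: the family of vector fields
`g(p) = ∑ l, g_l(p, v) ∂/∂v_l` and the functions `f(p₁, p₂, v)`, `λ(p₁, p₂, v)`. -/
@[ext]
structure GTData (m : ℕ) where
  g : ℂ → Fields m → Fields m
  f : ℂ → ℂ → Fields m → ℂ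
  lam : ℂ → ℂ → Fields m → ℂ

/-- `g`, `f` form a local GT structure on `P × V`. -/
structure IsLocalGT {m : ℕ} (P : Set ℂ) (V : Set (Fields m))
    (g : ℂ → Fields m → Fields m) (f : ℂ → ℂ → Fields m → ℂ) : Prop where
  holomorphic_g : IsHolomorphic P V g
  holomorphic_f : IsHolomorphicOffDiagonal P V f
  bracket : ∀ p₁ ∈ P, ∀ p₂ ∈ P, ∀ v ∈ V, p₁ ≠ p₂ →
    VectorField.lieBracket ℂ (g p₁) (g p₂) v =
      f p₂ p₁ v • dp g p₁ v - f p₁ p₂ v • dp g p₂ v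
        + (2 * dp₂ f p₂ p₁ v) • g p₁ v - (2 * dp₂ f p₁ p₂ v) • g p₂ v
  jacobi : ∀ p₁ ∈ P, ∀ p₂ ∈ P, ∀ p₃ ∈ P, ∀ v ∈ V, p₁ ≠ p₂ → p₁ ≠ p₃ → p₂ ≠ p₃ →
    alongField (g p₂) (f p₁ p₃) v - alongField (g p₁) (f p₂ p₃) v =
      f p₁ p₂ v * dp₁ f p₂ p₃ v - f p₂ p₁ v * dp₁ f p₁ p₃ v
        + f p₁ p₃ v * dp₂ f p₂ p₃ v - f p₂ p₃ v * dp₂ f p₁ p₃ v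
        + 2 * f p₂ p₃ v * dp₂ f p₁ p₂ v - 2 * f p₁ p₃ v * dp₂ f p₂ p₁ v
  pole_f : HasDiagonalResidue P V f (fun _ _ => 1)

/-- `g`, `f`, `λ` form an enhanced local GT structure on `P × V`. -/
structure IsEnhancedLocalGT {m : ℕ} (P : Set ℂ) (V : Set (Fields m)) (E : GTData m) : Prop where
  localGT : IsLocalGT P V E.g E.f
  holomorphic_lam : IsHolomorphicOffDiagonal P V E.lam
  lam_eq : ∀ p₁ ∈ P, ∀ p₂ ∈ P, ∀ p₃ ∈ P, ∀ v ∈ V, p₁ ≠ p₂ → p₁ ≠ p₃ → p₂ ≠ p₃ →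
    alongField (E.g p₁) (E.lam p₂ p₃) v =
      E.lam p₁ p₃ v * dp₂ E.lam p₂ p₁ v - E.lam p₂ p₃ v * dp₂ E.f p₁ p₂ v
        - E.f p₁ p₂ v * dp₁ E.lam p₂ p₃ v - E.f p₁ p₃ v * dp₂ E.lam p₂ p₃ v
  pole_lam : HasDiagonalResidue P V E.lam (fun _ _ => 1)

/-- `h` is a holomorphic solution on `P × V` of
`g(p₁)(h(p₂)) = λ(p₁, p₂) h'(p₁) - f(p₁, p₂) h'(p₂)`. -/
def IsPotential {m : ℕ} (P : Set ℂ) (V : Set (Fields m)) (E : GTData m)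
    (h : ℂ → Fields m → ℂ) : Prop :=
  IsHolomorphic P V h ∧
  ∀ p₁ ∈ P, ∀ p₂ ∈ P, ∀ v ∈ V, p₁ ≠ p₂ →
    alongField (E.g p₁) (h p₂) v = E.lam p₁ p₂ v * dp h p₁ v - E.f p₁ p₂ v * dp h p₂ v

/-- The space of solutions `h` of the linear functional equation of `IsPotential`. -/
def potentials {m : ℕ} (P : Set ℂ) (V : Set (Fields m)) (E : GTData m) :
    Set (ℂ → Fields m → ℂ) :=
  {h | IsPotential P V E h}

/-! Gibbons–Tsarev systems -/

/-- The data `f`, `g`, `q` of a system, for functions `p_1, ..., p_M, v_0, ..., v_m` of variables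
`r_1, ..., r_M`,
`∂_i p_j = f(p_i, p_j, v) ∂_i v_0` for `i ≠ j`, `∂_i v_l = g_l(p_i, v) ∂_i v_0`,
`∂_i ∂_j v_0 = q(p_i, p_j, v) ∂_i v_0 ∂_j v_0` for `i ≠ j`. -/
@[ext]
structure GTSystem (m : ℕ) where
  f : ℂ → ℂ → Fields m → ℂ
  g : ℂ → Fields m → Fields m
  q : ℂ → ℂ → Fields m → ℂ

/-- Values `(p, v, w)` of `p_1, ..., p_M`, of the fields `v`, and of `w_i = ∂_i v_0`. -/
abbrev Jet (m M : ℕ) : Type := (Fin M → ℂ) × Fields m × (Fin M → ℂ)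

/-- The jets at which the system is considered. -/
def jetDomain {m : ℕ} (P : Set ℂ) (V : Set (Fields m)) (M : ℕ) : Set (Jet m M) :=
  {x | (∀ i, x.1 i ∈ P) ∧ Function.Injective x.1 ∧ x.2.1 ∈ V}

/-- The derivatives `∂_i (p, v, w)` prescribed by the system. It does not prescribe `∂_i p_i` and
`∂_i w_i`; these two entries are set to `0`, and `GTSystem.D` is only applied to functions that
do not depend on `p_i` and `w_i`. -/
def GTSystem.velocity {m : ℕ} (S : GTSystem m) {M : ℕ} (i : Fin M) (x : Jet m M) : Jet m M :=
  (fun j => if j = i then 0 else S.f (x.1 i) (x.1 j) x.2.1 * x.2.2 i,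
   fun l => S.g (x.1 i) x.2.1 l * x.2.2 i,
   fun j => if j = i then 0 else S.q (x.1 i) (x.1 j) x.2.1 * x.2.2 i * x.2.2 j)

/-- The derivative `∂_i Φ(p, v, w)`, computed by virtue of the system. -/
noncomputable def GTSystem.D {m : ℕ} (S : GTSystem m) {M : ℕ} (i : Fin M)
    (Φ : Jet m M → ℂ) (x : Jet m M) : ℂ :=
  fderiv ℂ Φ x (S.velocity i x)

/-- Compatibility: for every number `M` of variables, `∂_i ∂_j = ∂_j ∂_i` holds for `i ≠ j` by
virtue of the system on all unknowns for which both sides are prescribed. -/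
def GTSystem.Compatible {m : ℕ} (P : Set ℂ) (V : Set (Fields m)) (S : GTSystem m) : Prop :=
  ∀ (M : ℕ) (x : Jet m M), x ∈ jetDomain P V M → ∀ i j : Fin M, i ≠ j →
    (∀ l, S.D i (fun y => (S.velocity j y).2.1 l) x = S.D j (fun y => (S.velocity i y).2.1 l) x) ∧
    (∀ k, k ≠ i → k ≠ j →
      S.D i (fun y => (S.velocity j y).1 k) x = S.D j (fun y => (S.velocity i y).1 k) x ∧
      S.D i (fun y => (S.velocity j y).2.2 k) x = S.D j (fun y => (S.velocity i y).2.2 k) x)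

/-- `S` is a non-degenerate Gibbons–Tsarev system on `P × V`: it is compatible, and `f` has a pole
of order exactly one on the diagonal. -/
structure IsGibbonsTsarev {m : ℕ} (P : Set ℂ) (V : Set (Fields m)) (S : GTSystem m) : Prop where
  holomorphic_f : IsHolomorphicOffDiagonal P V S.f
  holomorphic_g : IsHolomorphic P V S.g
  holomorphic_q : IsHolomorphicOffDiagonal P V S.q
  g_zero : ∀ p ∈ P, ∀ v ∈ V, S.g p v 0 = 1
  pole_f : ∃ ρ : ℂ → Fields m → ℂ, HasDiagonalResidue P V S.f ρ ∧ ∀ p ∈ P, ∀ v ∈ V, ρ p v ≠ 0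
  compatible : S.Compatible P V

open Classical in
/-- The Gibbons–Tsarev system of a local GT structure `g`, `f`:
`∂_i p_j = (f(p_i, p_j) / g_0(p_i)) ∂_i v_0`, `∂_i v_l / g_l(p_i) = ∂_i v_0 / g_0(p_i)`, and
`∂_1 ∂_2 v_0 = (2 f(p₁, p₂)_{p₂} / g_0(p₁)
  + (f(p₁, p₂) ∂/∂p₂ + g(p₁))(g_0(p₂)) / (g_0(p₁) g_0(p₂))) ∂_1 v_0 ∂_2 v_0`. -/
noncomputable def GTData.toSystem {m : ℕ} (P : Set ℂ) (V : Set (Fields m)) (E : GTData m) :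
    GTSystem m where
  f := fun p₁ p₂ v => if (p₁, p₂, v) ∈ offDiagonal P V then E.f p₁ p₂ v / E.g p₁ v 0 else 0
  g := fun p v l => if p ∈ P ∧ v ∈ V then E.g p v l / E.g p v 0 else 0
  q := fun p₁ p₂ v => if (p₁, p₂, v) ∈ offDiagonal P V then
      2 * dp₂ E.f p₁ p₂ v / E.g p₁ v 0
        + (E.f p₁ p₂ v * dp E.g p₂ v 0 + alongField (E.g p₁) (fun u => E.g p₂ u 0) v)
            / (E.g p₁ v 0 * E.g p₂ v 0)
    else 0

/-! Whitham type hierarchies and their hydrodynamic reductions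

A Whitham type hierarchy `∂ψ/∂t_h = h(z, v)` is given by its set `H` of potentials `h`; there is
one time `t_h` for each `h ∈ H`. -/

/-- The left-hand side of the compatibility condition of the equations `∂ψ/∂t_a = h_a(z, v)` for
three potentials `h₁, h₂, h₃`, as a function of the values `X_a` of `∂v/∂t_a`:
the sum over `l` of
`(h₁' ∂h₂/∂v_l - h₂' ∂h₁/∂v_l) ∂v_l/∂t₃ + (h₂' ∂h₃/∂v_l - h₃' ∂h₂/∂v_l) ∂v_l/∂t₁
  + (h₃' ∂h₁/∂v_l - h₁' ∂h₃/∂v_l) ∂v_l/∂t₂`. -/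
noncomputable def whithamForm {m : ℕ} (h₁ h₂ h₃ : ℂ → Fields m → ℂ) (z : ℂ) (v : Fields m)
    (X₁ X₂ X₃ : Fields m) : ℂ :=
  (dp h₁ z v * fderiv ℂ (h₂ z) v X₃ - dp h₂ z v * fderiv ℂ (h₁ z) v X₃)
    + (dp h₂ z v * fderiv ℂ (h₃ z) v X₁ - dp h₃ z v * fderiv ℂ (h₂ z) v X₁)
    + (dp h₃ z v * fderiv ℂ (h₁ z) v X₂ - dp h₁ z v * fderiv ℂ (h₃ z) v X₂)

/-- In an `M`-component reduction the Riemann invariants satisfy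
`∂r_k/∂t_h = h'(p_k) ρ_k` (so `∂r_k/∂t_h : ∂r_k/∂t_{h₀} = h'(p_k) : h₀'(p_k)` for all `h, h₀`),
and the fields are `v = v(r)`. This is the resulting value of `∂v/∂t_h`. -/
noncomputable def reducedFlow {m : ℕ} (S : GTSystem m) {M : ℕ} (x : Jet m M) (ρ : Fin M → ℂ)
    (h : ℂ → Fields m → ℂ) : Fields m :=
  ∑ k, (dp h (x.1 k) x.2.1 * ρ k) • (S.velocity k x).2.1

/-- The characteristic velocity `h'(p_k) / h₀'(p_k)` of the flow `t_h` relative to `t_{h₀}`. -/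
noncomputable def charVelocity {m M : ℕ} (h h₀ : ℂ → Fields m → ℂ) (k : Fin M) (x : Jet m M) : ℂ :=
  dp h (x.1 k) x.2.1 / dp h₀ (x.1 k) x.2.1

/-- The hydrodynamic reductions of the hierarchy `H` are parameterized by the solutions of the
Gibbons–Tsarev system `S`: for every `M`, by virtue of `S`,
* `v(r(t))` satisfies the equations of the hierarchy, for arbitrary values of the `ρ_k`;
* the diagonal systems `∂r_k/∂t_h = (h'(p_k) / h₀'(p_k)) ∂r_k/∂t_{h₀}` commute, i.e. their
  characteristic velocities `μ^k` satisfy Tsarev's condition that `∂_l μ^k / (μ^l - μ^k)` is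
  the same for all of them. -/
structure IntegrableBy {m : ℕ} (P : Set ℂ) (V : Set (Fields m)) (S : GTSystem m)
    (H : Set (ℂ → Fields m → ℂ)) : Prop where
  gibbonsTsarev : IsGibbonsTsarev P V S
  holomorphic : ∀ h ∈ H, IsHolomorphic P V h
  reduction : ∀ h₁ ∈ H, ∀ h₂ ∈ H, ∀ h₃ ∈ H, ∀ (M : ℕ) (x : Jet m M), x ∈ jetDomain P V M →
    ∀ (ρ : Fin M → ℂ), ∀ z ∈ P,
      whithamForm h₁ h₂ h₃ z x.2.1
        (reducedFlow S x ρ h₁) (reducedFlow S x ρ h₂) (reducedFlow S x ρ h₃) = 0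
  commute : ∀ h₀ ∈ H, ∀ h₁ ∈ H, ∀ h₂ ∈ H, ∀ (M : ℕ) (x : Jet m M), x ∈ jetDomain P V M →
    ∀ k l : Fin M, k ≠ l → dp h₀ (x.1 k) x.2.1 ≠ 0 → dp h₀ (x.1 l) x.2.1 ≠ 0 →
      S.D l (charVelocity h₁ h₀ k) x * (charVelocity h₂ h₀ l x - charVelocity h₂ h₀ k x) =
        S.D l (charVelocity h₂ h₀ k) x * (charVelocity h₁ h₀ l x - charVelocity h₁ h₀ k x)

/-- `H` is integrable by hydrodynamic reductions. -/
def IntegrableByReductions {m : ℕ} (P : Set ℂ) (V : Set (Fields m))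
    (H : Set (ℂ → Fields m → ℂ)) : Prop :=
  ∃ S : GTSystem m, IntegrableBy P V S H

/-- The derivatives `h'` of the potentials have no common zero, and there are three potentials
whose derivatives are linearly independent as functions of `p`, for some value of the fields. -/
def Nondegenerate {m : ℕ} (P : Set ℂ) (V : Set (Fields m))
    (H : Set (ℂ → Fields m → ℂ)) : Prop :=
  (∀ p ∈ P, ∀ v ∈ V, ∃ h ∈ H, dp h p v ≠ 0) ∧
  ∃ h : Fin 3 → ℂ → Fields m → ℂ, (∀ a, h a ∈ H) ∧
    ∃ v ∈ V, ∃ z : Fin 3 → ℂ, (∀ b, z b ∈ P) ∧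
      (Matrix.of fun a b => dp (h a) (z b) v).det ≠ 0

/-- `c` is a possible direction of `∂v/∂r` at `v` for a one-component wave `v(r)` with
`∂r/∂t_h` proportional to `h'(p)`. -/
def IsCharacteristic {m : ℕ} (P : Set ℂ) (H : Set (ℂ → Fields m → ℂ)) (p : ℂ) (v : Fields m)
    (c : Fields m) : Prop :=
  ∀ h₁ ∈ H, ∀ h₂ ∈ H, ∀ h₃ ∈ H, ∀ z ∈ P,
    whithamForm h₁ h₂ h₃ z v (dp h₁ p v • c) (dp h₂ p v • c) (dp h₃ p v • c) = 0

/-- For generic `(p, v)` the characteristic directions form at most a line. -/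
def HasSimpleCharacteristics {m : ℕ} (P : Set ℂ) (V : Set (Fields m))
    (H : Set (ℂ → Fields m → ℂ)) : Prop :=
  ∃ W : Set (ℂ × Fields m), IsOpen W ∧ W.Nonempty ∧ W ⊆ P ×ˢ V ∧
    ∀ x ∈ W, ∀ c c' : Fields m, IsCharacteristic P H x.1 x.2 c → IsCharacteristic P H x.1 x.2 c' →
      c ≠ 0 → ∃ μ : ℂ, c' = μ • c

/-- `E` is an enhanced local GT structure on `P × V` whose coefficient `g_0` has no zeros, so that
the associated Gibbons–Tsarev system is defined on all of `P × V`. -/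
def IsAdmissible {m : ℕ} (P : Set ℂ) (V : Set (Fields m)) (E : GTData m) : Prop :=
  IsEnhancedLocalGT P V E ∧ ∀ p ∈ P, ∀ v ∈ V, E.g p v 0 ≠ 0

/-! A Gibbons–Tsarev system and a local GT structure differ by a rescaling. If `f̂` has residue `ρ`
on the diagonal, multiplying `f̂(p₁, ·)` and `ĝ(p₁)` by `γ = 1/ρ` makes the residue one. Letting `p₃
→ p₂` in the symmetry of `∂₁∂₂p₃` expresses `q` through `f̂`, `ĝ`, `γ` (`IsGibbonsTsarev.isScale`).
For such `q`, symmetry of `∂₁∂₂v` is the bracket relation, symmetry of `∂₁∂₂p₃` is the relation for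
`f` (`bracket_iff`, `jacobi_iff`), and the condition on `∂₁∂₂∂₃v₀` is then automatic
(`mixedWeight_symm`).

The potentials enter linearly. For `p ≠ z` consider the vectors, indexed by `h ∈ H`, `a = h'(z)`, `b
= ĝ(p)(h(z))`, `c = h'(p)`, and `s`, `t`, the `z`-derivatives of `a`, `b`. The reductions say that
all minors of `(a, b, c)` vanish, and commutativity says the same of `(a, f̂ s + t, c)`. If `b + f̂
a` is a multiple of `c`, which is the functional equation up to scale, both follow. Conversely,
differentiating the first condition in `z` and subtracting the second puts `b + f̂ a` into the span
of `s, c` as well as of `a, c`, hence onto the line of `c` where `a, s, c` are independent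
(`lamNum_triple`). The identity theorem removes the genericity (`lamNum_mul_eq`), and the factor is
`λ` up to `γ`. Its differential equation results from applying `[g(p₁), g(p₂)]` to `h(p₃)`
(`lamDefect_mul_eq`).

Uniqueness: the residue of `f̂` recovers `g_0`, hence `g` and `f`, and the functional equation
recovers `λ`. With simple characteristics, `H` alone determines the direction of `g(p)` and then
`f̂`. The bijections follow formally by comparing the structures attached to nested hierarchies. -/

open Filter Topology

/-! ### Partial derivatives of jointly analytic functions and their interchange. -/

section Calculus

variable {m : ℕ} {F : Type*} [NormedAddCommGroup F] [NormedSpace ℂ F]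

/-- Joint analyticity of `φ(p, v)`. -/
def JointAnalyticAt (φ : ℂ → Fields m → F) (p : ℂ) (v : Fields m) : Prop :=
  AnalyticAt ℂ (fun x : ℂ × Fields m => φ x.1 x.2) (p, v)

/-- Joint analyticity of `φ(p₁, p₂, v)`. -/
def JointAnalyticAt₂ (φ : ℂ → ℂ → Fields m → ℂ) (p₁ p₂ : ℂ) (v : Fields m) : Prop :=
  AnalyticAt ℂ (fun x : ℂ × ℂ × Fields m => φ x.1 x.2.1 x.2.2) (p₁, p₂, v)

theorem fderiv_fderiv_apply_comm {E : Type*} [NormedAddCommGroup E] [NormedSpace ℂ E]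
    {G : Type*} [NormedAddCommGroup G] [NormedSpace ℂ G] [CompleteSpace G]
    {f : E → G} {x : E} (hf : AnalyticAt ℂ f x) (u w : E) :
    fderiv ℂ (fun y => fderiv ℂ f y u) x w = fderiv ℂ (fun y => fderiv ℂ f y w) x u := by
  have h1 : DifferentiableAt ℂ (fderiv ℂ f) x := hf.fderiv.differentiableAt
  have hs : IsSymmSndFDerivAt ℂ f x :=
    (hf.contDiffAt (n := ⊤)).isSymmSndFDerivAt (by simp)
  rw [fderiv_clm_apply h1 (by fun_prop), fderiv_clm_apply h1 (by fun_prop)]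
  simpa using hs w u

theorem AnalyticAt.clm_apply {E G K : Type*} [NormedAddCommGroup E] [NormedSpace ℂ E]
    [NormedAddCommGroup G] [NormedSpace ℂ G] [NormedAddCommGroup K] [NormedSpace ℂ K]
    {L : E → G →L[ℂ] K} {X : E → G} {x : E} (hL : AnalyticAt ℂ L x) (hX : AnalyticAt ℂ X x) :
    AnalyticAt ℂ (fun y => L y (X y)) x :=
  ((ContinuousLinearMap.id ℂ (G →L[ℂ] K)).analyticAt_bilinear (L x, X x)).comp₂ hL hX

namespace JointAnalyticAt

variable {φ : ℂ → Fields m → F} {p : ℂ} {v : Fields m}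

theorem hasDerivAt_comp {a : ℂ → ℂ} {b : ℂ → Fields m} {a' : ℂ} {b' : Fields m} {t : ℂ}
    (hφ : JointAnalyticAt φ (a t) (b t)) (ha : HasDerivAt a a' t) (hb : HasDerivAt b b' t) :
    HasDerivAt (fun s => φ (a s) (b s))
      (a' • dp φ (a t) (b t) + fderiv ℂ (φ (a t)) (b t) b') t := by
  set H : ℂ × Fields m → F := fun x => φ x.1 x.2 with hH
  have hd : HasFDerivAt H (fderiv ℂ H (a t, b t)) (a t, b t) := hφ.differentiableAt.hasFDerivAt
  have h1 : dp φ (a t) (b t) = fderiv ℂ H (a t, b t) (1, 0) := by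
    have : HasDerivAt (fun z : ℂ => (z, b t)) ((1 : ℂ), (0 : Fields m)) (a t) :=
      (hasDerivAt_id _).prodMk (hasDerivAt_const _ _)
    exact (hd.comp_hasDerivAt (a t) this).deriv
  have h2 : fderiv ℂ (φ (a t)) (b t) b' = fderiv ℂ H (a t, b t) (0, b') := by
    have : HasFDerivAt (fun u : Fields m => (a t, u))
      ((0 : Fields m →L[ℂ] ℂ).prod (ContinuousLinearMap.id ℂ _)) (b t) :=
      (hasFDerivAt_const _ _).prodMk (hasFDerivAt_id _)
    have h3 := (HasFDerivAt.comp (b t) (f := fun u : Fields m => (a t, u)) hd this).fderiv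
    have h4 : fderiv ℂ (φ (a t)) (b t) = _ := h3
    rw [h4]
    simp
  have h3 := hd.comp_hasDerivAt t (ha.prodMk hb)
  refine h3.congr_deriv ?_
  rw [h1, h2, ← map_smul, ← map_add]
  simp

theorem dp_eq (hφ : JointAnalyticAt φ p v) :
    dp φ p v = fderiv ℂ (fun x : ℂ × Fields m => φ x.1 x.2) (p, v) (1, 0) := by
  have hd := (AnalyticAt.differentiableAt hφ).hasFDerivAt
  have : HasDerivAt (fun z : ℂ => (z, v)) ((1 : ℂ), (0 : Fields m)) p :=
    (hasDerivAt_id _).prodMk (hasDerivAt_const _ _)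
  exact (hd.comp_hasDerivAt p this).deriv

theorem fderiv_eq (hφ : JointAnalyticAt φ p v) :
    fderiv ℂ (φ p) v = (fderiv ℂ (fun x : ℂ × Fields m => φ x.1 x.2) (p, v)).comp
      (ContinuousLinearMap.inr ℂ ℂ (Fields m)) := by
  have hd := (AnalyticAt.differentiableAt hφ).hasFDerivAt
  have : HasFDerivAt (fun u : Fields m => (p, u)) (ContinuousLinearMap.inr ℂ ℂ (Fields m)) v :=
    (hasFDerivAt_const _ _).prodMk (hasFDerivAt_id _)
  exact (HasFDerivAt.comp v (f := fun u : Fields m => (p, u)) hd this).fderiv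

theorem hasDerivAt_left (hφ : JointAnalyticAt φ p v) :
    HasDerivAt (fun z => φ z v) (dp φ p v) p := by
  simpa using hφ.hasDerivAt_comp (a := id) (b := fun _ => v) (t := p) (hasDerivAt_id p)
    (hasDerivAt_const _ _)

theorem right (hφ : JointAnalyticAt φ p v) : AnalyticAt ℂ (φ p) v :=
  AnalyticAt.comp (f := fun u : Fields m => (p, u)) (x := v) hφ (by fun_prop)

variable [CompleteSpace F]

theorem eventually (hφ : JointAnalyticAt φ p v) :
    ∀ᶠ x : ℂ × Fields m in 𝓝 (p, v), JointAnalyticAt φ x.1 x.2 :=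
  hφ.eventually_analyticAt

theorem dp (hφ : JointAnalyticAt φ p v) : JointAnalyticAt (dp φ) p v := by
  have h : AnalyticAt ℂ (fun x => fderiv ℂ (fun x : ℂ × Fields m => φ x.1 x.2) x (1, 0)) (p, v) :=
    (AnalyticAt.fderiv hφ).clm_apply analyticAt_const
  exact h.congr (hφ.eventually.mono fun x hx => hx.dp_eq.symm)

theorem fderiv_analyticAt (hφ : JointAnalyticAt φ p v) :
    AnalyticAt ℂ (fun x : ℂ × Fields m => fderiv ℂ (φ x.1) x.2) (p, v) := by
  have h : AnalyticAt ℂ (fun x => (ContinuousLinearMap.compL ℂ (Fields m) (ℂ × Fields m) F).flip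
      (ContinuousLinearMap.inr ℂ ℂ (Fields m))
      (fderiv ℂ (fun x : ℂ × Fields m => φ x.1 x.2) x)) (p, v) :=
    (ContinuousLinearMap.analyticAt _ _).comp (AnalyticAt.fderiv hφ)
  exact h.congr (hφ.eventually.mono fun x hx => hx.fderiv_eq.symm)

/-- Mixed partials in `p` and `v` commute. This is what lets identities for `h` be differentiated in
`p` into identities for `h'`. -/
theorem hasDerivAt_fderiv (hφ : JointAnalyticAt φ p v) (X : Fields m) :
    HasDerivAt (fun z => fderiv ℂ (φ z) v X) (fderiv ℂ (_root_.dp φ p) v X) p := by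
  set H : ℂ × Fields m → F := fun x => φ x.1 x.2 with hH
  have hH' : AnalyticAt ℂ H (p, v) := hφ
  have h1 : (fun x : ℂ × Fields m => fderiv ℂ (φ x.1) x.2 X) =ᶠ[𝓝 (p, v)]
      fun x => fderiv ℂ H x (0, X) :=
    hφ.eventually.mono fun x hx => by simp [hx.fderiv_eq, hH]
  have h2 : (fun x : ℂ × Fields m => _root_.dp φ x.1 x.2) =ᶠ[𝓝 (p, v)]
      fun x => fderiv ℂ H x (1, 0) :=
    hφ.eventually.mono fun x hx => hx.dp_eq
  have hA : JointAnalyticAt (fun z u => fderiv ℂ (φ z) u X) p v :=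
    hφ.fderiv_analyticAt.clm_apply analyticAt_const
  have h3 := hA.hasDerivAt_left
  rw [hA.dp_eq] at h3
  rw [hφ.dp.fderiv_eq]
  refine h3.congr_deriv ?_
  rw [h1.fderiv_eq, ContinuousLinearMap.comp_apply, h2.fderiv_eq]
  exact fderiv_fderiv_apply_comm hH' _ _

end JointAnalyticAt

namespace JointAnalyticAt₂

variable {φ : ℂ → ℂ → Fields m → ℂ} {p₁ p₂ : ℂ} {v : Fields m}

theorem eventually (hφ : JointAnalyticAt₂ φ p₁ p₂ v) :
    ∀ᶠ x : ℂ × ℂ × Fields m in 𝓝 (p₁, p₂, v), JointAnalyticAt₂ φ x.1 x.2.1 x.2.2 :=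
  hφ.eventually_analyticAt

theorem dp₁_eq (hφ : JointAnalyticAt₂ φ p₁ p₂ v) :
    dp₁ φ p₁ p₂ v = fderiv ℂ (fun x : ℂ × ℂ × Fields m => φ x.1 x.2.1 x.2.2) (p₁, p₂, v)
      (1, 0, 0) := by
  have hd := (AnalyticAt.differentiableAt hφ).hasFDerivAt
  have : HasDerivAt (fun z : ℂ => (z, p₂, v)) ((1 : ℂ), (0 : ℂ), (0 : Fields m)) p₁ :=
    (hasDerivAt_id _).prodMk (hasDerivAt_const _ _)
  exact (hd.comp_hasDerivAt p₁ this).deriv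

theorem dp₂_eq (hφ : JointAnalyticAt₂ φ p₁ p₂ v) :
    dp₂ φ p₁ p₂ v = fderiv ℂ (fun x : ℂ × ℂ × Fields m => φ x.1 x.2.1 x.2.2) (p₁, p₂, v)
      (0, 1, 0) := by
  have hd := (AnalyticAt.differentiableAt hφ).hasFDerivAt
  have : HasDerivAt (fun z : ℂ => (p₁, z, v)) ((0 : ℂ), (1 : ℂ), (0 : Fields m)) p₂ :=
    (hasDerivAt_const _ _).prodMk ((hasDerivAt_id _).prodMk (hasDerivAt_const _ _))
  exact (hd.comp_hasDerivAt p₂ this).deriv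

theorem fderiv_eq (hφ : JointAnalyticAt₂ φ p₁ p₂ v) :
    fderiv ℂ (φ p₁ p₂) v =
      (fderiv ℂ (fun x : ℂ × ℂ × Fields m => φ x.1 x.2.1 x.2.2) (p₁, p₂, v)).comp
      ((ContinuousLinearMap.inr ℂ ℂ (ℂ × Fields m)).comp
        (ContinuousLinearMap.inr ℂ ℂ (Fields m))) := by
  have hd := (AnalyticAt.differentiableAt hφ).hasFDerivAt
  have : HasFDerivAt (fun u : Fields m => (p₁, p₂, u))
      ((ContinuousLinearMap.inr ℂ ℂ (ℂ × Fields m)).comp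
        (ContinuousLinearMap.inr ℂ ℂ (Fields m))) v :=
    ((hasFDerivAt_const p₁ v).prodMk ((hasFDerivAt_const p₂ v).prodMk (hasFDerivAt_id v))).congr_fderiv
      (by ext <;> rfl)
  exact (HasFDerivAt.comp v (f := fun u : Fields m => (p₁, p₂, u)) hd this).fderiv

theorem hasDerivAt_comp {a b : ℂ → ℂ} {c : ℂ → Fields m} {a' b' : ℂ} {c' : Fields m} {t : ℂ}
    (hφ : JointAnalyticAt₂ φ (a t) (b t) (c t)) (ha : HasDerivAt a a' t) (hb : HasDerivAt b b' t)
    (hc : HasDerivAt c c' t) :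
    HasDerivAt (fun s => φ (a s) (b s) (c s))
      (a' * dp₁ φ (a t) (b t) (c t) + b' * dp₂ φ (a t) (b t) (c t)
        + fderiv ℂ (φ (a t) (b t)) (c t) c') t := by
  have hd := (AnalyticAt.differentiableAt hφ).hasFDerivAt
  have h3 := hd.comp_hasDerivAt t (ha.prodMk (hb.prodMk hc))
  refine h3.congr_deriv ?_
  rw [hφ.dp₁_eq, hφ.dp₂_eq, hφ.fderiv_eq, ← smul_eq_mul, ← smul_eq_mul, ← map_smul, ← map_smul,
    ContinuousLinearMap.comp_apply, ← map_add, ← map_add]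
  simp

theorem dp₁ (hφ : JointAnalyticAt₂ φ p₁ p₂ v) : JointAnalyticAt₂ (dp₁ φ) p₁ p₂ v := by
  have h : AnalyticAt ℂ (fun x => fderiv ℂ (fun x : ℂ × ℂ × Fields m => φ x.1 x.2.1 x.2.2) x
      (1, 0, 0)) (p₁, p₂, v) := (AnalyticAt.fderiv hφ).clm_apply analyticAt_const
  exact h.congr (hφ.eventually.mono fun x hx => hx.dp₁_eq.symm)

theorem dp₂ (hφ : JointAnalyticAt₂ φ p₁ p₂ v) : JointAnalyticAt₂ (dp₂ φ) p₁ p₂ v := by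
  have h : AnalyticAt ℂ (fun x => fderiv ℂ (fun x : ℂ × ℂ × Fields m => φ x.1 x.2.1 x.2.2) x
      (0, 1, 0)) (p₁, p₂, v) := (AnalyticAt.fderiv hφ).clm_apply analyticAt_const
  exact h.congr (hφ.eventually.mono fun x hx => hx.dp₂_eq.symm)

theorem fderiv_analyticAt (hφ : JointAnalyticAt₂ φ p₁ p₂ v) :
    AnalyticAt ℂ (fun x : ℂ × ℂ × Fields m => fderiv ℂ (φ x.1 x.2.1) x.2.2) (p₁, p₂, v) := by
  have h : AnalyticAt ℂ (fun x => (ContinuousLinearMap.compL ℂ (Fields m) (ℂ × ℂ × Fields m) ℂ).flip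
      ((ContinuousLinearMap.inr ℂ ℂ (ℂ × Fields m)).comp (ContinuousLinearMap.inr ℂ ℂ (Fields m)))
      (fderiv ℂ (fun x : ℂ × ℂ × Fields m => φ x.1 x.2.1 x.2.2) x)) (p₁, p₂, v) :=
    (ContinuousLinearMap.analyticAt _ _).comp (AnalyticAt.fderiv hφ)
  exact h.congr (hφ.eventually.mono fun x hx => hx.fderiv_eq.symm)

theorem hasDerivAt_left (hφ : JointAnalyticAt₂ φ p₁ p₂ v) :
    HasDerivAt (fun z => φ z p₂ v) (_root_.dp₁ φ p₁ p₂ v) p₁ := by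
  simpa using hφ.hasDerivAt_comp (a := id) (b := fun _ => p₂) (c := fun _ => v) (t := p₁)
    (hasDerivAt_id p₁) (hasDerivAt_const _ _) (hasDerivAt_const _ _)

theorem hasDerivAt_right (hφ : JointAnalyticAt₂ φ p₁ p₂ v) :
    HasDerivAt (fun z => φ p₁ z v) (_root_.dp₂ φ p₁ p₂ v) p₂ := by
  simpa using hφ.hasDerivAt_comp (a := fun _ => p₁) (b := id) (c := fun _ => v) (t := p₂)
    (hasDerivAt_const _ _) (hasDerivAt_id p₂) (hasDerivAt_const _ _)

theorem right (hφ : JointAnalyticAt₂ φ p₁ p₂ v) : AnalyticAt ℂ (φ p₁ p₂) v :=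
  AnalyticAt.comp (f := fun u : Fields m => (p₁, p₂, u)) (x := v) hφ (by fun_prop)

theorem hasDerivAt_right_dp₁ (hφ : JointAnalyticAt₂ φ p₁ p₂ v) :
    HasDerivAt (fun z => _root_.dp₁ φ p₁ z v) (_root_.dp₁ (_root_.dp₂ φ) p₁ p₂ v) p₂ := by
  have h1 : (fun x : ℂ × ℂ × Fields m => _root_.dp₁ φ x.1 x.2.1 x.2.2) =ᶠ[𝓝 (p₁, p₂, v)] _ :=
    hφ.eventually.mono fun x hx => hx.dp₁_eq
  have h2 : (fun x : ℂ × ℂ × Fields m => _root_.dp₂ φ x.1 x.2.1 x.2.2) =ᶠ[𝓝 (p₁, p₂, v)] _ :=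
    hφ.eventually.mono fun x hx => hx.dp₂_eq
  refine hφ.dp₁.hasDerivAt_right.congr_deriv ?_
  rw [hφ.dp₁.dp₂_eq, hφ.dp₂.dp₁_eq, h1.fderiv_eq, h2.fderiv_eq]
  exact fderiv_fderiv_apply_comm hφ _ _

theorem hasDerivAt_right_fderiv (hφ : JointAnalyticAt₂ φ p₁ p₂ v) (X : Fields m) :
    HasDerivAt (fun z => fderiv ℂ (φ p₁ z) v X) (fderiv ℂ (_root_.dp₂ φ p₁ p₂) v X) p₂ := by
  have h1 : (fun x : ℂ × ℂ × Fields m => fderiv ℂ (φ x.1 x.2.1) x.2.2 X) =ᶠ[𝓝 (p₁, p₂, v)]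
      fun x => fderiv ℂ (fun x : ℂ × ℂ × Fields m => φ x.1 x.2.1 x.2.2) x (0, 0, X) :=
    hφ.eventually.mono fun x hx => by simp [hx.fderiv_eq]
  have h2 : (fun x : ℂ × ℂ × Fields m => _root_.dp₂ φ x.1 x.2.1 x.2.2) =ᶠ[𝓝 (p₁, p₂, v)] _ :=
    hφ.eventually.mono fun x hx => hx.dp₂_eq
  have hA : JointAnalyticAt₂ (fun z w u => fderiv ℂ (φ z w) u X) p₁ p₂ v :=
    hφ.fderiv_analyticAt.clm_apply analyticAt_const
  refine hA.hasDerivAt_right.congr_deriv ?_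
  rw [hA.dp₂_eq, hφ.dp₂.fderiv_eq, h1.fderiv_eq, ContinuousLinearMap.comp_apply, h2.fderiv_eq]
  exact fderiv_fderiv_apply_comm hφ _ _

end JointAnalyticAt₂

end Calculus

/-! ### The identity theorem as a density principle. -/

section Density

/-- The non-vanishing locus of an analytic function that is not identically zero on a connected set
is dense, so a continuous function vanishing there vanishes everywhere. All later passages from
generic to arbitrary points of `P × P × V` use this form. -/
theorem eq_zero_of_continuousAt_of_forall_ne_zero {E : Type*} [NormedAddCommGroup E]
    [NormedSpace ℂ E] {U : Set E} {f : E → ℂ} (hf : AnalyticOnNhd ℂ f U) (hU : IsPreconnected U)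
    {x₀ : E} (hx₀ : x₀ ∈ U) (hfx₀ : f x₀ ≠ 0) {x : E} (hx : x ∈ U) {G : E → ℂ}
    (hG : ContinuousAt G x) (h : ∀ᶠ y in 𝓝 x, f y ≠ 0 → G y = 0) : G x = 0 := by
  by_contra hne
  have h0 : f =ᶠ[𝓝 x] 0 := by
    filter_upwards [h, hG.eventually_ne hne] with y hy hy'
    by_contra hfy
    exact hy' (hy hfy)
  exact hfx₀ (hf.eqOn_zero_of_preconnected_of_eventuallyEq_zero hU hx h0 hx₀)

theorem exists_mul_ne_zero {E : Type*} [NormedAddCommGroup E] [NormedSpace ℂ E] {U : Set E}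
    (hUo : IsOpen U) (hU : IsPreconnected U) {f g : E → ℂ} (hf : AnalyticOnNhd ℂ f U)
    (hg : AnalyticOnNhd ℂ g U) (hf0 : ∃ x ∈ U, f x ≠ 0) (hg0 : ∃ x ∈ U, g x ≠ 0) :
    ∃ x ∈ U, f x * g x ≠ 0 := by
  by_contra! hcon
  obtain ⟨x, hx, hfx⟩ := hf0
  obtain ⟨y, hy, hgy⟩ := hg0
  refine hgy (eq_zero_of_continuousAt_of_forall_ne_zero hf hU hx hfx hy (hg y hy).continuousAt ?_)
  filter_upwards [hUo.mem_nhds hy] with z hz hfz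
  exact (mul_eq_zero.1 (hcon z hz)).resolve_left hfz

end Density

/-! ### Holomorphy on the product domain and off the diagonal. -/

section Domain

variable {m : ℕ} {P : Set ℂ} {V : Set (Fields m)}

theorem isOpen_offDiagonal (hP : IsOpen P) (hV : IsOpen V) : IsOpen (offDiagonal P V) := by
  have h : offDiagonal P V = (P ×ˢ (P ×ˢ V)) ∩ {x | x.1 ≠ x.2.1} := by
    ext x
    simp only [offDiagonal, Set.mem_ofPred_eq, Set.mem_inter_iff, Set.mem_prod, and_assoc]
  rw [h]
  exact (hP.prod (hP.prod hV)).inter (isOpen_ne_fun (by fun_prop) (by fun_prop))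

theorem IsHolomorphic.jointAnalyticAt {F : Type*} [NormedAddCommGroup F] [NormedSpace ℂ F]
    {φ : ℂ → Fields m → F} (h : IsHolomorphic P V φ) {p : ℂ} {v : Fields m} (hp : p ∈ P)
    (hv : v ∈ V) : JointAnalyticAt φ p v :=
  h.analytic (p, v) ⟨hp, hv⟩

theorem IsHolomorphicOffDiagonal.jointAnalyticAt {φ : ℂ → ℂ → Fields m → ℂ}
    (h : IsHolomorphicOffDiagonal P V φ) {p₁ p₂ : ℂ} {v : Fields m} (hp₁ : p₁ ∈ P)
    (hp₂ : p₂ ∈ P) (hv : v ∈ V) (hne : p₁ ≠ p₂) : JointAnalyticAt₂ φ p₁ p₂ v :=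
  h.analytic (p₁, p₂, v) ⟨hp₁, hp₂, hv, hne⟩

theorem JointAnalyticAt.fderiv_apply {F : Type*} [NormedAddCommGroup F] [NormedSpace ℂ F]
    {φ : ℂ → Fields m → F} {p : ℂ} {v : Fields m} (h : JointAnalyticAt φ p v) (a : ℂ)
    (X : Fields m) :
    fderiv ℂ (fun x : ℂ × Fields m => φ x.1 x.2) (p, v) (a, X) =
      a • _root_.dp φ p v + fderiv ℂ (φ p) v X := by
  rw [h.dp_eq, h.fderiv_eq, ContinuousLinearMap.comp_apply, ← map_smul, ← map_add]
  simp

end Domain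

/-! ### Compatibility of a Gibbons–Tsarev system as symmetry of mixed derivatives. -/

namespace GTSystem

variable {m M : ℕ} (S : GTSystem m) {x : Jet m M}

theorem velocity_fst {i j : Fin M} (h : j ≠ i) :
    (S.velocity i x).1 j = S.f (x.1 i) (x.1 j) x.2.1 * x.2.2 i := by
  simp [velocity, h]

theorem velocity_fields (i : Fin M) :
    (S.velocity i x).2.1 = x.2.2 i • S.g (x.1 i) x.2.1 := by
  ext l
  simp [velocity, mul_comm]

theorem velocity_weight {i j : Fin M} (h : j ≠ i) :
    (S.velocity i x).2.2 j = S.q (x.1 i) (x.1 j) x.2.1 * x.2.2 i * x.2.2 j := by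
  simp [velocity, h]

theorem hasDerivAt_D {i : Fin M} {Φ : Jet m M → ℂ} (hΦ : DifferentiableAt ℂ Φ x) :
    HasDerivAt (fun t : ℂ => Φ (x + t • S.velocity i x)) (S.D i Φ x) 0 := by
  have h1 : HasDerivAt (fun t : ℂ => x + t • S.velocity i x) (S.velocity i x) 0 := by
    simpa using ((hasDerivAt_id (0 : ℂ)).smul_const (S.velocity i x)).const_add x
  have h2 : HasFDerivAt Φ (fderiv ℂ Φ x) (x + (0 : ℂ) • S.velocity i x) := by
    simpa using hΦ.hasFDerivAt
  exact h2.comp_hasDerivAt 0 h1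

theorem D_eq_of_hasDerivAt {i : Fin M} {Φ : Jet m M → ℂ} {d : ℂ} (hΦ : DifferentiableAt ℂ Φ x)
    (h : HasDerivAt (fun t : ℂ => Φ (x + t • S.velocity i x)) d 0) : S.D i Φ x = d :=
  (S.hasDerivAt_D hΦ).unique h

theorem D_mul {i : Fin M} {Φ Ψ : Jet m M → ℂ} (hΦ : DifferentiableAt ℂ Φ x)
    (hΨ : DifferentiableAt ℂ Ψ x) :
    S.D i (fun y => Φ y * Ψ y) x = S.D i Φ x * Ψ x + Φ x * S.D i Ψ x := by
  simp only [D]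
  rw [fderiv_fun_mul hΦ hΨ]
  simp
  ring

theorem D_div {i : Fin M} {Φ Ψ : Jet m M → ℂ} (hΦ : DifferentiableAt ℂ Φ x)
    (hΨ : DifferentiableAt ℂ Ψ x) (h0 : Ψ x ≠ 0) :
    S.D i (fun y => Φ y / Ψ y) x = (S.D i Φ x * Ψ x - Φ x * S.D i Ψ x) / Ψ x ^ 2 := by
  have hd : DifferentiableAt ℂ (fun y => Φ y / Ψ y) x := by
    simp only [div_eq_mul_inv]
    exact hΦ.mul (hΨ.inv h0)
  refine S.D_eq_of_hasDerivAt hd ?_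
  have h := (S.hasDerivAt_D (i := i) hΦ).fun_div (S.hasDerivAt_D (i := i) hΨ) (by simpa using h0)
  simpa using h

theorem D_weight (i j : Fin M) : S.D i (fun y => y.2.2 j) x = (S.velocity i x).2.2 j := by
  refine S.D_eq_of_hasDerivAt (by fun_prop) ?_
  simpa using ((hasDerivAt_id (0 : ℂ)).mul_const ((S.velocity i x).2.2 j)).const_add (x.2.2 j)

theorem differentiableAt_comp {φ : ℂ → Fields m → ℂ} {k : Fin M}
    (hφ : JointAnalyticAt φ (x.1 k) x.2.1) :
    DifferentiableAt ℂ (fun y : Jet m M => φ (y.1 k) y.2.1) x :=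
  DifferentiableAt.comp (g := fun x : ℂ × Fields m => φ x.1 x.2)
    (f := fun y : Jet m M => (y.1 k, y.2.1)) x (AnalyticAt.differentiableAt hφ) (by fun_prop)

theorem differentiableAt_comp₂ {φ : ℂ → ℂ → Fields m → ℂ} {j k : Fin M}
    (hφ : JointAnalyticAt₂ φ (x.1 j) (x.1 k) x.2.1) :
    DifferentiableAt ℂ (fun y : Jet m M => φ (y.1 j) (y.1 k) y.2.1) x :=
  DifferentiableAt.comp (g := fun x : ℂ × ℂ × Fields m => φ x.1 x.2.1 x.2.2)
    (f := fun y : Jet m M => (y.1 j, y.1 k, y.2.1)) x (AnalyticAt.differentiableAt hφ)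
    (by fun_prop)

theorem hasDerivAt_line_fst (W : Jet m M) (j : Fin M) :
    HasDerivAt (fun t : ℂ => (x + t • W).1 j) (W.1 j) 0 := by
  simpa using ((hasDerivAt_id (0 : ℂ)).mul_const (W.1 j)).const_add (x.1 j)

theorem hasDerivAt_line_fields (W : Jet m M) :
    HasDerivAt (fun t : ℂ => (x + t • W).2.1) W.2.1 0 := by
  simpa using ((hasDerivAt_id (0 : ℂ)).smul_const W.2.1).const_add x.2.1

theorem D_comp {i k : Fin M} {φ : ℂ → Fields m → ℂ} (hφ : JointAnalyticAt φ (x.1 k) x.2.1) :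
    S.D i (fun y => φ (y.1 k) y.2.1) x =
      (S.velocity i x).1 k * dp φ (x.1 k) x.2.1
        + fderiv ℂ (φ (x.1 k)) x.2.1 (S.velocity i x).2.1 := by
  refine S.D_eq_of_hasDerivAt (differentiableAt_comp hφ) ?_
  have h := JointAnalyticAt.hasDerivAt_comp (φ := φ) (by simpa using hφ)
    (hasDerivAt_line_fst (x := x) (S.velocity i x) k) (hasDerivAt_line_fields (x := x) (S.velocity i x))
  simpa using h

theorem D_comp₂ {i j k : Fin M} {φ : ℂ → ℂ → Fields m → ℂ}
    (hφ : JointAnalyticAt₂ φ (x.1 j) (x.1 k) x.2.1) :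
    S.D i (fun y => φ (y.1 j) (y.1 k) y.2.1) x =
      (S.velocity i x).1 j * dp₁ φ (x.1 j) (x.1 k) x.2.1
        + (S.velocity i x).1 k * dp₂ φ (x.1 j) (x.1 k) x.2.1
        + fderiv ℂ (φ (x.1 j) (x.1 k)) x.2.1 (S.velocity i x).2.1 := by
  refine S.D_eq_of_hasDerivAt (differentiableAt_comp₂ hφ) ?_
  have h := JointAnalyticAt₂.hasDerivAt_comp (φ := φ) (by simpa using hφ)
    (hasDerivAt_line_fst (x := x) (S.velocity i x) j)
    (hasDerivAt_line_fst (x := x) (S.velocity i x) k) (hasDerivAt_line_fields (x := x) (S.velocity i x))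
  simpa using h

/-- `∂₁∂₂ v`, divided by `∂₁v₀ ∂₂v₀`. -/
noncomputable def mixedFields (p₁ p₂ : ℂ) (v : Fields m) : Fields m :=
  S.f p₁ p₂ v • dp S.g p₂ v + fderiv ℂ (S.g p₂) v (S.g p₁ v) + S.q p₁ p₂ v • S.g p₂ v

/-- `∂₁∂₂ p₃`, divided by `∂₁v₀ ∂₂v₀`. -/
noncomputable def mixedPoint (p₁ p₂ p₃ : ℂ) (v : Fields m) : ℂ :=
  S.f p₁ p₂ v * dp₁ S.f p₂ p₃ v + S.f p₁ p₃ v * dp₂ S.f p₂ p₃ v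
    + fderiv ℂ (S.f p₂ p₃) v (S.g p₁ v) + S.q p₁ p₂ v * S.f p₂ p₃ v

/-- `∂₁∂₂∂₃ v₀`, divided by `∂₁v₀ ∂₂v₀ ∂₃v₀`. -/
noncomputable def mixedWeight (p₁ p₂ p₃ : ℂ) (v : Fields m) : ℂ :=
  S.f p₁ p₂ v * dp₁ S.q p₂ p₃ v + S.f p₁ p₃ v * dp₂ S.q p₂ p₃ v
    + fderiv ℂ (S.q p₂ p₃) v (S.g p₁ v) + S.q p₁ p₂ v * S.q p₂ p₃ v
    + S.q p₁ p₃ v * S.q p₂ p₃ v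

variable {S} {P : Set ℂ} {V : Set (Fields m)}

theorem dp_apply {g : ℂ → Fields m → Fields m} {p : ℂ} {v : Fields m}
    (hg : JointAnalyticAt g p v) (l : Fin (m + 1)) :
    dp (fun p v => g p v l) p v = dp g p v l :=
  (hasDerivAt_pi.1 hg.hasDerivAt_left l).deriv

theorem fderiv_component {g : Fields m → Fields m} {v : Fields m}
    (hg : DifferentiableAt ℂ g v) (X : Fields m) (l : Fin (m + 1)) :
    fderiv ℂ (fun u => g u l) v X = fderiv ℂ g v X l := by
  rw [(hasFDerivAt_pi'.1 hg.hasFDerivAt l).fderiv]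
  rfl

theorem _root_.JointAnalyticAt.component {g : ℂ → Fields m → Fields m} {p : ℂ} {v : Fields m}
    (hg : JointAnalyticAt g p v) (l : Fin (m + 1)) : JointAnalyticAt (fun p v => g p v l) p v :=
  ((ContinuousLinearMap.proj (R := ℂ) (φ := fun _ : Fin (m + 1) => ℂ) l).analyticAt _).comp hg

/-- The differentiated function is `g_l(p_j, v) w_j`. It involves neither `p_i` nor `w_i`, so the
conventional zeros in `velocity` never enter; the same holds in the next two lemmas. -/
theorem D_velocity_fields (hg : IsHolomorphic P V S.g) (hx : x ∈ jetDomain P V M)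
    {i j : Fin M} (hij : i ≠ j) (l : Fin (m + 1)) :
    S.D i (fun y => (S.velocity j y).2.1 l) x =
      S.mixedFields (x.1 i) (x.1 j) x.2.1 l * x.2.2 i * x.2.2 j := by
  have hgj := hg.jointAnalyticAt (hx.1 j) hx.2.2
  have h1 := S.D_mul (i := i) (differentiableAt_comp (hgj.component l))
    (Ψ := fun y => y.2.2 j) (by fun_prop)
  refine h1.trans ?_
  rw [S.D_comp (hgj.component l), D_weight, velocity_fst _ hij.symm, velocity_weight _ hij.symm,
    velocity_fields, dp_apply hgj, fderiv_component hgj.right.differentiableAt, map_smul]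
  simp only [mixedFields, Pi.add_apply, Pi.smul_apply, smul_eq_mul]
  ring

theorem D_velocity_fst (hf : IsHolomorphicOffDiagonal P V S.f) (hx : x ∈ jetDomain P V M)
    {i j k : Fin M} (hij : i ≠ j) (hik : i ≠ k) (hjk : j ≠ k) :
    S.D i (fun y => (S.velocity j y).1 k) x =
      S.mixedPoint (x.1 i) (x.1 j) (x.1 k) x.2.1 * x.2.2 i * x.2.2 j := by
  have hfjk := hf.jointAnalyticAt (hx.1 j) (hx.1 k) hx.2.2 (hx.2.1.ne hjk)
  have h1 := S.D_mul (i := i) (differentiableAt_comp₂ hfjk)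
    (Ψ := fun y => y.2.2 j) (by fun_prop)
  simp only [velocity_fst S hjk.symm]
  refine h1.trans ?_
  rw [S.D_comp₂ hfjk, D_weight, velocity_fst _ hij.symm, velocity_fst _ hik.symm,
    velocity_weight _ hij.symm, velocity_fields, map_smul]
  simp only [mixedPoint, smul_eq_mul]
  ring

theorem D_velocity_weight (hq : IsHolomorphicOffDiagonal P V S.q) (hx : x ∈ jetDomain P V M)
    {i j k : Fin M} (hij : i ≠ j) (hik : i ≠ k) (hjk : j ≠ k) :
    S.D i (fun y => (S.velocity j y).2.2 k) x =
      S.mixedWeight (x.1 i) (x.1 j) (x.1 k) x.2.1 * x.2.2 i * x.2.2 j * x.2.2 k := by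
  have hqjk := hq.jointAnalyticAt (hx.1 j) (hx.1 k) hx.2.2 (hx.2.1.ne hjk)
  have hd := differentiableAt_comp₂ hqjk
  have h1 := S.D_mul (i := i) hd (Ψ := fun y => y.2.2 j) (by fun_prop)
  have h2 := S.D_mul (i := i) (hd.mul (by fun_prop : DifferentiableAt ℂ (fun y => y.2.2 j) x))
    (Ψ := fun y => y.2.2 k) (by fun_prop)
  simp only [velocity_weight S hjk.symm]
  refine h2.trans ?_
  simp only [Pi.mul_apply] at h1 ⊢
  have h3 : S.D i ((fun y : Jet m M => S.q (y.1 j) (y.1 k) y.2.1) * fun y => y.2.2 j) x = _ := h1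
  rw [h3, S.D_comp₂ hqjk, D_weight, D_weight, velocity_fst _ hij.symm, velocity_fst _ hik.symm,
    velocity_weight _ hij.symm, velocity_weight _ hik.symm, velocity_fields, map_smul]
  simp only [mixedWeight, smul_eq_mul]
  ring

theorem compatible_of_symm (hf : IsHolomorphicOffDiagonal P V S.f) (hg : IsHolomorphic P V S.g)
    (hq : IsHolomorphicOffDiagonal P V S.q)
    (h₁ : ∀ p₁ ∈ P, ∀ p₂ ∈ P, ∀ v ∈ V, p₁ ≠ p₂ → S.mixedFields p₁ p₂ v = S.mixedFields p₂ p₁ v)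
    (h₂ : ∀ p₁ ∈ P, ∀ p₂ ∈ P, ∀ p₃ ∈ P, ∀ v ∈ V, p₁ ≠ p₂ → p₁ ≠ p₃ → p₂ ≠ p₃ →
      S.mixedPoint p₁ p₂ p₃ v = S.mixedPoint p₂ p₁ p₃ v)
    (h₃ : ∀ p₁ ∈ P, ∀ p₂ ∈ P, ∀ p₃ ∈ P, ∀ v ∈ V, p₁ ≠ p₂ → p₁ ≠ p₃ → p₂ ≠ p₃ →
      S.mixedWeight p₁ p₂ p₃ v = S.mixedWeight p₂ p₁ p₃ v) : S.Compatible P V := by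
  intro M x hx i j hij
  have ne {a b : Fin M} (h : a ≠ b) : x.1 a ≠ x.1 b := hx.2.1.ne h
  refine ⟨fun l => ?_, fun k hki hkj => ⟨?_, ?_⟩⟩
  · rw [D_velocity_fields hg hx hij, D_velocity_fields hg hx hij.symm,
      h₁ _ (hx.1 i) _ (hx.1 j) _ hx.2.2 (ne hij)]
    ring
  · rw [D_velocity_fst hf hx hij hki.symm hkj.symm, D_velocity_fst hf hx hij.symm hkj.symm hki.symm,
      h₂ _ (hx.1 i) _ (hx.1 j) _ (hx.1 k) _ hx.2.2 (ne hij) (ne hki.symm) (ne hkj.symm)]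
    ring
  · rw [D_velocity_weight hq hx hij hki.symm hkj.symm,
      D_velocity_weight hq hx hij.symm hkj.symm hki.symm,
      h₃ _ (hx.1 i) _ (hx.1 j) _ (hx.1 k) _ hx.2.2 (ne hij) (ne hki.symm) (ne hkj.symm)]
    ring

/-- Two points with unit weights suffice, since the weights only contribute a common monomial
factor. -/
theorem Compatible.mixedFields_symm (h : S.Compatible P V) (hg : IsHolomorphic P V S.g)
    {p₁ p₂ : ℂ} {v : Fields m} (hp₁ : p₁ ∈ P) (hp₂ : p₂ ∈ P) (hv : v ∈ V) (hne : p₁ ≠ p₂) :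
    S.mixedFields p₁ p₂ v = S.mixedFields p₂ p₁ v := by
  have hx : ((![p₁, p₂], v, fun _ => 1) : Jet m 2) ∈ jetDomain P V 2 := by
    refine ⟨by simp [Fin.forall_fin_two, hp₁, hp₂], ?_, hv⟩
    intro i j
    fin_cases i <;> fin_cases j <;> simp [hne, hne.symm]
  ext l
  have h1 := (h 2 _ hx 0 1 (by simp)).1 l
  rw [D_velocity_fields hg hx (by simp), D_velocity_fields hg hx (by simp)] at h1
  simpa using h1

theorem Compatible.mixedPoint_symm (h : S.Compatible P V) (hf : IsHolomorphicOffDiagonal P V S.f)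
    {p₁ p₂ p₃ : ℂ} {v : Fields m} (hp₁ : p₁ ∈ P) (hp₂ : p₂ ∈ P) (hp₃ : p₃ ∈ P) (hv : v ∈ V)
    (h12 : p₁ ≠ p₂) (h13 : p₁ ≠ p₃) (h23 : p₂ ≠ p₃) :
    S.mixedPoint p₁ p₂ p₃ v = S.mixedPoint p₂ p₁ p₃ v := by
  have hx : ((![p₁, p₂, p₃], v, fun _ => 1) : Jet m 3) ∈ jetDomain P V 3 := by
    refine ⟨by simp [Fin.forall_fin_succ, hp₁, hp₂, hp₃], ?_, hv⟩
    intro i j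
    fin_cases i <;> fin_cases j <;> simp [h12, h13, h23, h12.symm, h13.symm, h23.symm]
  have h1 := ((h 3 _ hx 0 1 (by simp)).2 2 (by decide) (by decide)).1
  rw [D_velocity_fst hf hx (by simp) (by decide) (by decide),
    D_velocity_fst hf hx (by simp) (by decide) (by decide)] at h1
  simpa using h1

end GTSystem

/-! ### Rescaling a Gibbons–Tsarev system into a local GT structure. -/

section Rescaling

variable {m : ℕ} {P : Set ℂ} {V : Set (Fields m)}

theorem eventually_mem_offDiagonal (hP : IsOpen P) (hV : IsOpen V) {p₁ p₂ : ℂ} {v : Fields m}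
    (hp₁ : p₁ ∈ P) (hp₂ : p₂ ∈ P) (hv : v ∈ V) (hne : p₁ ≠ p₂) :
    ∀ᶠ x : ℂ × ℂ × Fields m in 𝓝 (p₁, p₂, v), x ∈ offDiagonal P V :=
  (isOpen_offDiagonal hP hV).mem_nhds ⟨hp₁, hp₂, hv, hne⟩

theorem hasDerivAt_add_smul {E : Type*} [NormedAddCommGroup E] [NormedSpace ℂ E] (x w : E) :
    HasDerivAt (fun t : ℂ => x + t • w) w 0 := by
  simpa using ((hasDerivAt_id (0 : ℂ)).smul_const w).const_add x

theorem hasDerivAt_fderiv_comp {E : Type*} [NormedAddCommGroup E] [NormedSpace ℂ E]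
    {f : E → ℂ} {y Y : ℂ → E} {y' Y' : E} {t : ℂ} (hf : AnalyticAt ℂ f (y t))
    (hy : HasDerivAt y y' t) (hY : HasDerivAt Y Y' t) :
    HasDerivAt (fun s => fderiv ℂ f (y s) (Y s))
      (fderiv ℂ (fderiv ℂ f) (y t) y' (Y t) + fderiv ℂ f (y t) Y') t :=
  (hf.fderiv.differentiableAt.hasFDerivAt.comp_hasDerivAt t hy).clm_apply hY

namespace GTSystem

variable (S : GTSystem m) (γ : ℂ → Fields m → ℂ)

/-- After the rescaling `∂_i = γ(p_i) D_i` the system takes the form of a local GT structure: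
`∂_i v_0 = γ(p_i) u_i` with `∂_i u_j = 2 γ(p_i) f(p_i, p_j)_{p_j} u_i u_j`. -/
structure IsScale (P : Set ℂ) (V : Set (Fields m)) : Prop where
  analytic : ∀ p ∈ P, ∀ v ∈ V, JointAnalyticAt γ p v
  ne_zero : ∀ p ∈ P, ∀ v ∈ V, γ p v ≠ 0
  q_eq : ∀ p₁ ∈ P, ∀ p₂ ∈ P, ∀ v ∈ V, p₁ ≠ p₂ →
    S.q p₁ p₂ v = 2 * dp₂ S.f p₁ p₂ v
      + (S.f p₁ p₂ v * dp γ p₂ v + fderiv ℂ (γ p₂) v (S.g p₁ v)) / γ p₂ v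

/-- The data obtained from the system by multiplying `f(p₁, ·)` and `g(p₁)` by `γ(p₁)`. -/
def rescale (lam : ℂ → ℂ → Fields m → ℂ) : GTData m where
  g := fun p v => γ p v • S.g p v
  f := fun p₁ p₂ v => γ p₁ v * S.f p₁ p₂ v
  lam := lam

variable {S γ} {lam : ℂ → ℂ → Fields m → ℂ}

theorem dp_rescale_g {p : ℂ} {v : Fields m} (hγ : JointAnalyticAt γ p v)
    (hg : JointAnalyticAt S.g p v) :
    dp (S.rescale γ lam).g p v = γ p v • dp S.g p v + dp γ p v • S.g p v :=
  (hγ.hasDerivAt_left.smul hg.hasDerivAt_left).deriv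

theorem fderiv_rescale_g {p : ℂ} {v : Fields m} (hγ : JointAnalyticAt γ p v)
    (hg : JointAnalyticAt S.g p v) (X : Fields m) :
    fderiv ℂ ((S.rescale γ lam).g p) v X =
      γ p v • fderiv ℂ (S.g p) v X + fderiv ℂ (γ p) v X • S.g p v := by
  have h := (hγ.right.differentiableAt.hasFDerivAt.smul
    hg.right.differentiableAt.hasFDerivAt).fderiv
  have h' : fderiv ℂ ((S.rescale γ lam).g p) v = _ := h
  rw [h']
  simp

theorem dp₁_rescale_f {p₁ p₂ : ℂ} {v : Fields m} (hγ : JointAnalyticAt γ p₁ v)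
    (hf : JointAnalyticAt₂ S.f p₁ p₂ v) :
    dp₁ (S.rescale γ lam).f p₁ p₂ v = dp γ p₁ v * S.f p₁ p₂ v + γ p₁ v * dp₁ S.f p₁ p₂ v :=
  (hγ.hasDerivAt_left.mul hf.hasDerivAt_left).deriv

theorem dp₂_rescale_f {p₁ p₂ : ℂ} {v : Fields m} (hf : JointAnalyticAt₂ S.f p₁ p₂ v) :
    dp₂ (S.rescale γ lam).f p₁ p₂ v = γ p₁ v * dp₂ S.f p₁ p₂ v :=
  (hf.hasDerivAt_right.const_mul (γ p₁ v)).deriv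

theorem fderiv_rescale_f {p₁ p₂ : ℂ} {v : Fields m} (hγ : JointAnalyticAt γ p₁ v)
    (hf : JointAnalyticAt₂ S.f p₁ p₂ v) (X : Fields m) :
    fderiv ℂ ((S.rescale γ lam).f p₁ p₂) v X =
      γ p₁ v * fderiv ℂ (S.f p₁ p₂) v X + S.f p₁ p₂ v * fderiv ℂ (γ p₁) v X := by
  have h := (hγ.right.differentiableAt.hasFDerivAt.mul
    hf.right.differentiableAt.hasFDerivAt).fderiv
  have h' : fderiv ℂ ((S.rescale γ lam).f p₁ p₂) v = _ := h
  rw [h']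
  simp

/-- The derivatives of `γ` produced by the bracket and by `g'` are those contained in `q`, so the
defect of the bracket relation is `γ(p₁)γ(p₂)` times the antisymmetrization of `mixedFields`. -/
theorem IsScale.bracket_iff (h : S.IsScale γ P V) (hf : IsHolomorphicOffDiagonal P V S.f)
    (hg : IsHolomorphic P V S.g) {p₁ p₂ : ℂ} {v : Fields m} (hp₁ : p₁ ∈ P) (hp₂ : p₂ ∈ P)
    (hv : v ∈ V) (hne : p₁ ≠ p₂) {E : GTData m} (hE : E = S.rescale γ lam) :
    VectorField.lieBracket ℂ (E.g p₁) (E.g p₂) v =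
      E.f p₂ p₁ v • dp E.g p₁ v - E.f p₁ p₂ v • dp E.g p₂ v
        + (2 * dp₂ E.f p₂ p₁ v) • E.g p₁ v - (2 * dp₂ E.f p₁ p₂ v) • E.g p₂ v ↔
    S.mixedFields p₁ p₂ v = S.mixedFields p₂ p₁ v := by
  subst hE
  have hγ₁ := h.analytic p₁ hp₁ v hv
  have hγ₂ := h.analytic p₂ hp₂ v hv
  have hg₁ := hg.jointAnalyticAt hp₁ hv
  have hg₂ := hg.jointAnalyticAt hp₂ hv
  have n₁ := h.ne_zero p₁ hp₁ v hv
  have n₂ := h.ne_zero p₂ hp₂ v hv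
  have key : VectorField.lieBracket ℂ ((S.rescale γ lam).g p₁) ((S.rescale γ lam).g p₂) v
      - ((S.rescale γ lam).f p₂ p₁ v • dp (S.rescale γ lam).g p₁ v
        - (S.rescale γ lam).f p₁ p₂ v • dp (S.rescale γ lam).g p₂ v
        + (2 * dp₂ (S.rescale γ lam).f p₂ p₁ v) • (S.rescale γ lam).g p₁ v
        - (2 * dp₂ (S.rescale γ lam).f p₁ p₂ v) • (S.rescale γ lam).g p₂ v) =
      (γ p₁ v * γ p₂ v) • (S.mixedFields p₁ p₂ v - S.mixedFields p₂ p₁ v) := by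
    rw [VectorField.lieBracket, fderiv_rescale_g hγ₁ hg₁, fderiv_rescale_g hγ₂ hg₂,
      dp_rescale_g hγ₁ hg₁, dp_rescale_g hγ₂ hg₂,
      dp₂_rescale_f (hf.jointAnalyticAt hp₁ hp₂ hv hne),
      dp₂_rescale_f (hf.jointAnalyticAt hp₂ hp₁ hv hne.symm), mixedFields, mixedFields,
      h.q_eq p₁ hp₁ p₂ hp₂ v hv hne, h.q_eq p₂ hp₂ p₁ hp₁ v hv hne.symm]
    ext l
    simp only [rescale, map_smul, Pi.add_apply, Pi.sub_apply, Pi.smul_apply, smul_eq_mul]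
    field_simp
    ring
  rw [← sub_eq_zero, key, smul_eq_zero, sub_eq_zero]
  simp [n₁, n₂]

theorem IsScale.jacobi_iff (h : S.IsScale γ P V) (hf : IsHolomorphicOffDiagonal P V S.f)
    {p₁ p₂ p₃ : ℂ} {v : Fields m} (hp₁ : p₁ ∈ P) (hp₂ : p₂ ∈ P) (hp₃ : p₃ ∈ P)
    (hv : v ∈ V) (h12 : p₁ ≠ p₂) (h13 : p₁ ≠ p₃) (h23 : p₂ ≠ p₃)
    {E : GTData m} (hE : E = S.rescale γ lam) :
    alongField (E.g p₂) (E.f p₁ p₃) v - alongField (E.g p₁) (E.f p₂ p₃) v =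
      E.f p₁ p₂ v * dp₁ E.f p₂ p₃ v - E.f p₂ p₁ v * dp₁ E.f p₁ p₃ v
        + E.f p₁ p₃ v * dp₂ E.f p₂ p₃ v - E.f p₂ p₃ v * dp₂ E.f p₁ p₃ v
        + 2 * E.f p₂ p₃ v * dp₂ E.f p₁ p₂ v - 2 * E.f p₁ p₃ v * dp₂ E.f p₂ p₁ v ↔
    S.mixedPoint p₁ p₂ p₃ v = S.mixedPoint p₂ p₁ p₃ v := by
  subst hE
  have hγ₁ := h.analytic p₁ hp₁ v hv
  have hγ₂ := h.analytic p₂ hp₂ v hv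
  have n₁ := h.ne_zero p₁ hp₁ v hv
  have n₂ := h.ne_zero p₂ hp₂ v hv
  have f12 := hf.jointAnalyticAt hp₁ hp₂ hv h12
  have f21 := hf.jointAnalyticAt hp₂ hp₁ hv h12.symm
  have f13 := hf.jointAnalyticAt hp₁ hp₃ hv h13
  have f23 := hf.jointAnalyticAt hp₂ hp₃ hv h23
  simp only [alongField]
  rw [fderiv_rescale_f hγ₁ f13, fderiv_rescale_f hγ₂ f23, dp₁_rescale_f hγ₁ f13,
    dp₁_rescale_f hγ₂ f23, dp₂_rescale_f f13, dp₂_rescale_f f23, dp₂_rescale_f f12,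
    dp₂_rescale_f f21, mixedPoint, mixedPoint, h.q_eq p₁ hp₁ p₂ hp₂ v hv h12,
    h.q_eq p₂ hp₂ p₁ hp₁ v hv h12.symm]
  simp only [rescale, map_smul, smul_eq_mul]
  constructor
  · intro hj
    have hm : γ p₁ v * γ p₂ v ≠ 0 := mul_ne_zero n₁ n₂
    apply mul_left_cancel₀ hm
    field_simp
    linear_combination -hj
  · intro hj
    field_simp at hj
    linear_combination -hj

/-- Differentiating the symmetry of `∂₁∂₂ p₃` in `p₃`. -/
theorem mixedPoint_deriv_symm (hPo : IsOpen P) (hf : IsHolomorphicOffDiagonal P V S.f)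
    (h₂ : ∀ p₁ ∈ P, ∀ p₂ ∈ P, ∀ p₃ ∈ P, ∀ v ∈ V, p₁ ≠ p₂ → p₁ ≠ p₃ → p₂ ≠ p₃ →
      S.mixedPoint p₁ p₂ p₃ v = S.mixedPoint p₂ p₁ p₃ v)
    {p₁ p₂ p₃ : ℂ} {v : Fields m} (hp₁ : p₁ ∈ P) (hp₂ : p₂ ∈ P) (hp₃ : p₃ ∈ P)
    (hv : v ∈ V) (h12 : p₁ ≠ p₂) (h13 : p₁ ≠ p₃) (h23 : p₂ ≠ p₃) :
    S.f p₁ p₂ v * dp₁ (dp₂ S.f) p₂ p₃ v + S.f p₁ p₃ v * dp₂ (dp₂ S.f) p₂ p₃ v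
      + fderiv ℂ (dp₂ S.f p₂ p₃) v (S.g p₁ v) + S.q p₁ p₂ v * dp₂ S.f p₂ p₃ v =
    S.f p₂ p₁ v * dp₁ (dp₂ S.f) p₁ p₃ v + S.f p₂ p₃ v * dp₂ (dp₂ S.f) p₁ p₃ v
      + fderiv ℂ (dp₂ S.f p₁ p₃) v (S.g p₂ v) + S.q p₂ p₁ v * dp₂ S.f p₁ p₃ v := by
  have key : ∀ {a b : ℂ}, a ∈ P → b ∈ P → a ≠ p₃ → b ≠ p₃ →
      HasDerivAt (fun z => S.mixedPoint a b z v)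
        (S.f a b v * dp₁ (dp₂ S.f) b p₃ v + (dp₂ S.f a p₃ v * dp₂ S.f b p₃ v
          + S.f a p₃ v * dp₂ (dp₂ S.f) b p₃ v)
          + fderiv ℂ (dp₂ S.f b p₃) v (S.g a v) + S.q a b v * dp₂ S.f b p₃ v) p₃ := by
    intro a b ha hb ha3 hb3
    have fa := hf.jointAnalyticAt ha hp₃ hv ha3
    have fb := hf.jointAnalyticAt hb hp₃ hv hb3
    exact (((fb.hasDerivAt_right_dp₁.const_mul _).add
      (fa.hasDerivAt_right.mul fb.dp₂.hasDerivAt_right)).add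
      (fb.hasDerivAt_right_fderiv _)).add (fb.hasDerivAt_right.const_mul _)
  -- Differentiation also produces `f(p₁, p₃)_{p₃} f(p₂, p₃)_{p₃}` on both sides; being symmetric,
  -- it cancels.
  have hev : (fun z => S.mixedPoint p₁ p₂ z v) =ᶠ[𝓝 p₃] fun z => S.mixedPoint p₂ p₁ z v := by
    filter_upwards [hPo.mem_nhds hp₃, isOpen_ne.mem_nhds h13.symm, isOpen_ne.mem_nhds h23.symm]
      with z hz hz1 hz2
    exact h₂ p₁ hp₁ p₂ hp₂ z hz v hv h12 (Ne.symm hz1) (Ne.symm hz2)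
  have h := (key hp₁ hp₂ h13 h23).unique ((key hp₂ hp₁ h23 h13).congr_of_eventuallyEq hev)
  linear_combination h

/-- The last compatibility condition is free: `q(p_b, p₃)` is `2 f(p_b, p₃)_{p₃}` plus the
derivative of `log γ(p₃, v)` along the `b`-th flow. Symmetry reduces to the `p₃`-derivative of the
symmetry of `mixedPoint`, to `dγ` evaluated on symmetric arguments, and to the symmetry of the
Hessian of `γ`. -/
theorem IsScale.mixedWeight_symm (h : S.IsScale γ P V) (hPo : IsOpen P) (hVo : IsOpen V)
    (hf : IsHolomorphicOffDiagonal P V S.f) (hg : IsHolomorphic P V S.g)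
    (hq : IsHolomorphicOffDiagonal P V S.q)
    (h₁ : ∀ p₁ ∈ P, ∀ p₂ ∈ P, ∀ v ∈ V, p₁ ≠ p₂ → S.mixedFields p₁ p₂ v = S.mixedFields p₂ p₁ v)
    (h₂ : ∀ p₁ ∈ P, ∀ p₂ ∈ P, ∀ p₃ ∈ P, ∀ v ∈ V, p₁ ≠ p₂ → p₁ ≠ p₃ → p₂ ≠ p₃ →
      S.mixedPoint p₁ p₂ p₃ v = S.mixedPoint p₂ p₁ p₃ v)
    {p₁ p₂ p₃ : ℂ} {v : Fields m} (hp₁ : p₁ ∈ P) (hp₂ : p₂ ∈ P) (hp₃ : p₃ ∈ P)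
    (hv : v ∈ V) (h12 : p₁ ≠ p₂) (h13 : p₁ ≠ p₃) (h23 : p₂ ≠ p₃) :
    S.mixedWeight p₁ p₂ p₃ v = S.mixedWeight p₂ p₁ p₃ v := by
  set Γ : ℂ × Fields m → ℂ := fun x => γ x.1 x.2 with hΓ
  have hγ₃ := h.analytic p₃ hp₃ v hv
  have n₃ := h.ne_zero p₃ hp₃ v hv
  have hΓa : AnalyticAt ℂ Γ (p₃, v) := hγ₃
  have hq' : ∀ {a b : ℂ} {u : Fields m}, a ∈ P → b ∈ P → u ∈ V → a ≠ b →
      S.q a b u = 2 * dp₂ S.f a b u + fderiv ℂ Γ (b, u) (S.f a b u, S.g a u) / γ b u := by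
    intro a b u ha hb hu hab
    rw [h.q_eq a ha b hb u hu hab, hΓ, (h.analytic b hb u hu).fderiv_apply]
    simp
  have key : ∀ {a b : ℂ}, a ∈ P → b ∈ P → a ≠ b → a ≠ p₃ → b ≠ p₃ →
      S.mixedWeight a b p₃ v =
        2 * (S.f a b v * dp₁ (dp₂ S.f) b p₃ v + S.f a p₃ v * dp₂ (dp₂ S.f) b p₃ v
          + fderiv ℂ (dp₂ S.f b p₃) v (S.g a v) + S.q a b v * dp₂ S.f b p₃ v)
        + (fderiv ℂ (fderiv ℂ Γ) (p₃, v) (S.f a p₃ v, S.g a v) (S.f b p₃ v, S.g b v)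
          + fderiv ℂ Γ (p₃, v) (S.mixedPoint a b p₃ v, S.mixedFields a b v)) / γ p₃ v
        - fderiv ℂ Γ (p₃, v) (S.f b p₃ v, S.g b v) * fderiv ℂ Γ (p₃, v) (S.f a p₃ v, S.g a v)
          / γ p₃ v ^ 2
        + S.q a p₃ v * S.q b p₃ v := by
    intro a b ha hb hab ha3 hb3
    have fb := hf.jointAnalyticAt hb hp₃ hv hb3
    have qb := hq.jointAnalyticAt hb hp₃ hv hb3
    have gb := hg.jointAnalyticAt hb hv
    -- Straight lines tangent to the flow of `a` replace the flow itself, as only first derivatives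
    -- at `t = 0` are needed.
    set B : ℂ → ℂ := fun t => b + t • S.f a b v with hB
    set C : ℂ → ℂ := fun t => p₃ + t • S.f a p₃ v with hC
    set U : ℂ → Fields m := fun t => v + t • S.g a v with hU
    have B0 : B 0 = b := by simp [hB]
    have C0 : C 0 = p₃ := by simp [hC]
    have U0 : U 0 = v := by simp [hU]
    have dB : HasDerivAt B (S.f a b v) 0 := hasDerivAt_add_smul _ _
    have dC : HasDerivAt C (S.f a p₃ v) 0 := hasDerivAt_add_smul _ _
    have dU : HasDerivAt U (S.g a v) 0 := hasDerivAt_add_smul _ _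
    have dq := JointAnalyticAt₂.hasDerivAt_comp (φ := S.q) (by rwa [B0, C0, U0]) dB dC dU
    have df := JointAnalyticAt₂.hasDerivAt_comp (φ := S.f) (by rwa [B0, C0, U0]) dB dC dU
    have df2 := JointAnalyticAt₂.hasDerivAt_comp (φ := dp₂ S.f)
      (by rw [B0, C0, U0]; exact fb.dp₂) dB dC dU
    have dg := JointAnalyticAt.hasDerivAt_comp (φ := S.g) (by rwa [B0, U0]) dB dU
    have dγ := JointAnalyticAt.hasDerivAt_comp (φ := γ) (by rwa [C0, U0]) dC dU
    have dΓ := hasDerivAt_fderiv_comp (f := Γ) (by rw [C0, U0]; exact hΓa) (dC.prodMk dU)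
      (df.prodMk dg)
    have dR := (df2.const_mul 2).add (dΓ.fun_div dγ (by simpa [C0, U0] using n₃))
    have hev : (fun t => S.q (B t) (C t) (U t)) =ᶠ[𝓝 0] fun t => 2 * dp₂ S.f (B t) (C t) (U t)
        + fderiv ℂ Γ (C t, U t) (S.f (B t) (C t) (U t), S.g (B t) (U t)) / γ (C t) (U t) := by
      have hc : Tendsto (fun t => (B t, C t, U t)) (𝓝 0) (𝓝 (b, p₃, v)) := by
        have : ContinuousAt (fun t => (B t, C t, U t)) 0 :=
          dB.continuousAt.prodMk (dC.continuousAt.prodMk dU.continuousAt)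
        simpa [ContinuousAt, B0, C0, U0] using this
      filter_upwards [hc.eventually (eventually_mem_offDiagonal hPo hVo hb hp₃ hv hb3)] with t ht
      exact hq' ht.1 ht.2.1 ht.2.2.1 ht.2.2.2
    have huniq := dq.unique (dR.congr_of_eventuallyEq hev)
    simp only [B0, C0, U0] at huniq
    rw [mixedWeight, huniq, hq' hb hp₃ hv hb3]
    -- The summand `q(a, b) q(b, p₃)` of `mixedWeight` supplies the last terms of `mixedPoint` and
    -- `mixedFields`.
    have hlin : fderiv ℂ Γ (p₃, v) (S.mixedPoint a b p₃ v, S.mixedFields a b v) =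
        fderiv ℂ Γ (p₃, v) (S.f a b v * dp₁ S.f b p₃ v + S.f a p₃ v * dp₂ S.f b p₃ v
            + fderiv ℂ (S.f b p₃) v (S.g a v),
          S.f a b v • dp S.g b v + fderiv ℂ (S.g b) v (S.g a v))
        + S.q a b v * fderiv ℂ Γ (p₃, v) (S.f b p₃ v, S.g b v) := by
      rw [← smul_eq_mul (S.q a b v), ← map_smul, ← map_add]
      rfl
    have hγd : fderiv ℂ Γ (p₃, v) (S.f a p₃ v, S.g a v) =
        S.f a p₃ v • dp γ p₃ v + fderiv ℂ (γ p₃) v (S.g a v) := hγ₃.fderiv_apply _ _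
    rw [hlin, ← hγd]
    field_simp
    ring
  have hsymm : fderiv ℂ (fderiv ℂ Γ) (p₃, v) (S.f p₁ p₃ v, S.g p₁ v) (S.f p₂ p₃ v, S.g p₂ v) =
      fderiv ℂ (fderiv ℂ Γ) (p₃, v) (S.f p₂ p₃ v, S.g p₂ v) (S.f p₁ p₃ v, S.g p₁ v) :=
    ((hΓa.contDiffAt (n := ⊤)).isSymmSndFDerivAt (by simp)) _ _
  rw [key hp₁ hp₂ h12 h13 h23, key hp₂ hp₁ h12.symm h23 h13,
    mixedPoint_deriv_symm hPo hf h₂ hp₁ hp₂ hp₃ hv h12 h13 h23,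
    h₁ p₁ hp₁ p₂ hp₂ v hv h12, h₂ p₁ hp₁ p₂ hp₂ p₃ hp₃ v hv h12 h13 h23, hsymm]
  ring

end GTSystem

end Rescaling

/-! ### From an enhanced structure to an integrable hierarchy. -/

section Forward

variable {m : ℕ} {P : Set ℂ} {V : Set (Fields m)} {E : GTData m}

theorem JointAnalyticAt.comp_first {F : Type*} [NormedAddCommGroup F] [NormedSpace ℂ F]
    {φ : ℂ → Fields m → F} {p₁ p₂ : ℂ} {v : Fields m} (h : JointAnalyticAt φ p₁ v) :
    AnalyticAt ℂ (fun x : ℂ × ℂ × Fields m => φ x.1 x.2.2) (p₁, p₂, v) :=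
  AnalyticAt.comp (f := fun x : ℂ × ℂ × Fields m => (x.1, x.2.2)) (x := (p₁, p₂, v)) h
    (((ContinuousLinearMap.fst ℂ ℂ (ℂ × Fields m)).prod
      ((ContinuousLinearMap.snd ℂ ℂ (Fields m)).comp
        (ContinuousLinearMap.snd ℂ ℂ (ℂ × Fields m)))).analyticAt _)

theorem JointAnalyticAt.comp_second {F : Type*} [NormedAddCommGroup F] [NormedSpace ℂ F]
    {φ : ℂ → Fields m → F} {p₁ p₂ : ℂ} {v : Fields m} (h : JointAnalyticAt φ p₂ v) :
    AnalyticAt ℂ (fun x : ℂ × ℂ × Fields m => φ x.2.1 x.2.2) (p₁, p₂, v) :=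
  AnalyticAt.comp (f := fun x : ℂ × ℂ × Fields m => x.2) (x := (p₁, p₂, v)) h
    ((ContinuousLinearMap.snd ℂ ℂ (ℂ × Fields m)).analyticAt _)

theorem IsHolomorphicOffDiagonal.of_ite (hP : IsOpen P) (hV : IsOpen V)
    [∀ x : ℂ × ℂ × Fields m, Decidable (x ∈ offDiagonal P V)] {φ : ℂ → ℂ → Fields m → ℂ}
    (h : ∀ p₁ ∈ P, ∀ p₂ ∈ P, ∀ v ∈ V, p₁ ≠ p₂ → JointAnalyticAt₂ φ p₁ p₂ v) :
    IsHolomorphicOffDiagonal P V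
      (fun p₁ p₂ v => if (p₁, p₂, v) ∈ offDiagonal P V then φ p₁ p₂ v else 0) where
  analytic := fun x hx => by
    refine AnalyticAt.congr (h x.1 hx.1 x.2.1 hx.2.1 x.2.2 hx.2.2.1 hx.2.2.2) ?_
    filter_upwards [(isOpen_offDiagonal hP hV).mem_nhds hx] with y hy
    exact (if_pos hy).symm
  zero_outside := fun p₁ p₂ v h => if_neg h

theorem eq_zero_of_punctured {G : ℂ → ℂ} {p : ℂ} (hG : ContinuousAt G p)
    (h : ∀ᶠ z in 𝓝 p, z ≠ p → G z = 0) : G p = 0 := by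
  have h1 : Tendsto G (𝓝[≠] p) (𝓝 (G p)) := hG.tendsto.mono_left nhdsWithin_le_nhds
  have h2 : Tendsto G (𝓝[≠] p) (𝓝 0) :=
    tendsto_const_nhds.congr' ((eventually_nhdsWithin_iff.2 h).mono fun z hz => hz.symm)
  exact tendsto_nhds_unique h1 h2

theorem IsCharacteristic.smul {H : Set (ℂ → Fields m → ℂ)} {p : ℂ} {v c : Fields m}
    (h : IsCharacteristic P H p v c) (a : ℂ) : IsCharacteristic P H p v (a • c) := by
  intro h₁ H₁ h₂ H₂ h₃ H₃ z hz
  have := h h₁ H₁ h₂ H₂ h₃ H₃ z hz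
  simp only [whithamForm, map_smul, smul_eq_mul] at this ⊢
  linear_combination a * this

theorem whithamForm_sum {ι : Type*} (s : Finset ι) (h₁ h₂ h₃ : ℂ → Fields m → ℂ) (z : ℂ)
    (v : Fields m) (X₁ X₂ X₃ : ι → Fields m) :
    whithamForm h₁ h₂ h₃ z v (∑ k ∈ s, X₁ k) (∑ k ∈ s, X₂ k) (∑ k ∈ s, X₃ k) =
      ∑ k ∈ s, whithamForm h₁ h₂ h₃ z v (X₁ k) (X₂ k) (X₃ k) := by
  simp only [whithamForm, map_sum, Finset.mul_sum, Finset.sum_add_distrib, Finset.sum_sub_distrib]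

theorem IsPotential.fderiv_eq {h : ℂ → Fields m → ℂ} (hh : IsPotential P V E h) {p z : ℂ}
    {v : Fields m} (hp : p ∈ P) (hz : z ∈ P) (hv : v ∈ V) (hne : p ≠ z) :
    fderiv ℂ (h z) v (E.g p v) = E.lam p z v * dp h p v - E.f p z v * dp h z v :=
  hh.2 p hp z hz v hv hne

/-- The `z`-derivative of the functional equation, legitimate because `z ≠ p` is an open condition.
-/
theorem IsPotential.fderiv_dp_eq (hP : IsOpen P) (hf : IsHolomorphicOffDiagonal P V E.f)
    (hl : IsHolomorphicOffDiagonal P V E.lam) {h : ℂ → Fields m → ℂ}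
    (hh : IsPotential P V E h) {p z : ℂ} {v : Fields m} (hp : p ∈ P) (hz : z ∈ P) (hv : v ∈ V)
    (hne : p ≠ z) :
    fderiv ℂ (dp h z) v (E.g p v) = dp₂ E.lam p z v * dp h p v - dp₂ E.f p z v * dp h z v
      - E.f p z v * dp (dp h) z v := by
  have hz' := hh.1.jointAnalyticAt hz hv
  have h1 := hz'.hasDerivAt_fderiv (E.g p v)
  have h2 := (((hl.jointAnalyticAt hp hz hv hne).hasDerivAt_right.mul_const (dp h p v)).sub
    ((hf.jointAnalyticAt hp hz hv hne).hasDerivAt_right.mul hz'.dp.hasDerivAt_left))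
  have hev : (fun z => fderiv ℂ (h z) v (E.g p v)) =ᶠ[𝓝 z]
      fun z => E.lam p z v * dp h p v - E.f p z v * dp h z v := by
    filter_upwards [hP.mem_nhds hz, isOpen_ne.mem_nhds hne.symm] with y hy hyp
    exact hh.fderiv_eq hp hy hv (Ne.symm hyp)
  have := h1.unique (h2.congr_of_eventuallyEq hev)
  linear_combination this

/-- The form is the determinant with rows `h'(z)`, `g(p)(h(z))`, `h'(p)` over three potentials, and
the functional equation makes these rows dependent for `z ≠ p`. The value at `z = p` follows by
continuity in `z`. -/
theorem isCharacteristic_of_subset_potentials (hP : IsOpen P) {H : Set (ℂ → Fields m → ℂ)}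
    (hH : H ⊆ potentials P V E) {p : ℂ} {v : Fields m} (hp : p ∈ P) (hv : v ∈ V) :
    IsCharacteristic P H p v (E.g p v) := by
  intro h₁ H₁ h₂ H₂ h₃ H₃
  have key : ∀ z ∈ P, z ≠ p → whithamForm h₁ h₂ h₃ z v (dp h₁ p v • E.g p v)
      (dp h₂ p v • E.g p v) (dp h₃ p v • E.g p v) = 0 := by
    intro z hz hne
    simp only [whithamForm, map_smul, smul_eq_mul, (hH H₁).fderiv_eq hp hz hv hne.symm,
      (hH H₂).fderiv_eq hp hz hv hne.symm, (hH H₃).fderiv_eq hp hz hv hne.symm]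
    ring
  intro z hz
  by_cases hne : z = p
  · subst hne
    have c : ∀ {h}, h ∈ H → ContinuousAt (fun y => dp h y v) z := fun hh =>
      ((hH hh).1.jointAnalyticAt hp hv).dp.hasDerivAt_left.continuousAt
    have d : ∀ {h}, h ∈ H → ∀ X, ContinuousAt (fun y => fderiv ℂ (h y) v X) z := fun hh X =>
      (((hH hh).1.jointAnalyticAt hp hv).hasDerivAt_fderiv X).continuousAt
    refine eq_zero_of_punctured (G := fun y => whithamForm h₁ h₂ h₃ y v (dp h₁ z v • E.g z v)
      (dp h₂ z v • E.g z v) (dp h₃ z v • E.g z v)) ?_ ?_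
    · simp only [whithamForm]
      exact ((((c H₁).mul (d H₂ _)).sub ((c H₂).mul (d H₁ _))).add
        (((c H₂).mul (d H₃ _)).sub ((c H₃).mul (d H₂ _)))).add
        (((c H₃).mul (d H₁ _)).sub ((c H₁).mul (d H₃ _)))
    · filter_upwards [hP.mem_nhds hp] with y hy hyz using key y hy hyz
  · exact key z hz hne

theorem GTSystem.D_charVelocity (S : GTSystem m) {M : ℕ} {x : Jet m M}
    {h h₀ : ℂ → Fields m → ℂ} {k l : Fin M} (hh : JointAnalyticAt h (x.1 k) x.2.1)
    (hh₀ : JointAnalyticAt h₀ (x.1 k) x.2.1) (hne : dp h₀ (x.1 k) x.2.1 ≠ 0) (hkl : k ≠ l) :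
    S.D l (charVelocity h h₀ k) x =
      x.2.2 l * ((S.f (x.1 l) (x.1 k) x.2.1 * dp (dp h) (x.1 k) x.2.1
          + fderiv ℂ (dp h (x.1 k)) x.2.1 (S.g (x.1 l) x.2.1)) * dp h₀ (x.1 k) x.2.1
        - dp h (x.1 k) x.2.1 * (S.f (x.1 l) (x.1 k) x.2.1 * dp (dp h₀) (x.1 k) x.2.1
          + fderiv ℂ (dp h₀ (x.1 k)) x.2.1 (S.g (x.1 l) x.2.1))) / dp h₀ (x.1 k) x.2.1 ^ 2 := by
  refine (S.D_div (differentiableAt_comp hh.dp) (differentiableAt_comp hh₀.dp) hne).trans ?_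
  rw [S.D_comp hh.dp, S.D_comp hh₀.dp, velocity_fst _ hkl, velocity_fields, map_smul, map_smul]
  simp only [smul_eq_mul]
  ring

namespace IsAdmissible

theorem toSystem_f (hE : IsAdmissible P V E) (p₁ p₂ : ℂ) (v : Fields m) :
    (E.toSystem P V).f p₁ p₂ v = E.f p₁ p₂ v / E.g p₁ v 0 := by
  simp only [GTData.toSystem]
  split_ifs with h
  · rfl
  · rw [hE.1.localGT.holomorphic_f.zero_outside _ _ _ h, zero_div]

theorem toSystem_g (hE : IsAdmissible P V E) (p : ℂ) (v : Fields m) :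
    (E.toSystem P V).g p v = (E.g p v 0)⁻¹ • E.g p v := by
  ext l
  simp only [GTData.toSystem]
  split_ifs with h
  · simp [div_eq_inv_mul]
  · simp [hE.1.localGT.holomorphic_g.zero_outside _ _ h]

theorem jointAnalyticAt_scale (hE : IsAdmissible P V E) {p : ℂ} {v : Fields m} (hp : p ∈ P)
    (hv : v ∈ V) : JointAnalyticAt (fun p v => E.g p v 0) p v :=
  (hE.1.localGT.holomorphic_g.jointAnalyticAt hp hv).component 0

/-- Transfers the equivalences proved for rescaled systems to `E`. Outside the domain both sides
vanish, by the extension by zero. -/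
theorem eq_rescale (hE : IsAdmissible P V E) :
    E = (E.toSystem P V).rescale (fun p v => E.g p v 0) E.lam := by
  ext p
  · rename_i v l
    simp only [GTSystem.rescale, hE.toSystem_g, Pi.smul_apply, smul_eq_mul]
    by_cases h : p ∈ P ∧ v ∈ V
    · field_simp [hE.2 p h.1 v h.2]
    · simp [hE.1.localGT.holomorphic_g.zero_outside _ _ h]
  · rename_i p₂ v
    simp only [GTSystem.rescale, hE.toSystem_f]
    by_cases h : (p, p₂, v) ∈ offDiagonal P V
    · field_simp [hE.2 p h.1 v h.2.2.1]
    · simp [hE.1.localGT.holomorphic_f.zero_outside _ _ _ h]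
  · rfl

theorem holomorphic_toSystem_f (hP : IsOpen P) (hV : IsOpen V) (hE : IsAdmissible P V E) :
    IsHolomorphicOffDiagonal P V (E.toSystem P V).f := by
  classical
  refine IsHolomorphicOffDiagonal.of_ite hP hV fun p₁ hp₁ p₂ hp₂ v hv hne => ?_
  exact AnalyticAt.div (hE.1.localGT.holomorphic_f.jointAnalyticAt hp₁ hp₂ hv hne)
    (hE.jointAnalyticAt_scale hp₁ hv).comp_first (hE.2 p₁ hp₁ v hv)

theorem holomorphic_toSystem_g (hE : IsAdmissible P V E) :
    IsHolomorphic P V (E.toSystem P V).g where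
  analytic := fun x hx => by
    have h1 : AnalyticAt ℂ (fun x : ℂ × Fields m => (E.g x.1 x.2 0)⁻¹ • E.g x.1 x.2) x :=
      (AnalyticAt.inv (hE.jointAnalyticAt_scale hx.1 hx.2) (hE.2 _ hx.1 _ hx.2)).smul
        (hE.1.localGT.holomorphic_g.analytic x hx)
    simpa only [hE.toSystem_g] using h1
  zero_outside := fun p v h => by
    rw [hE.toSystem_g, hE.1.localGT.holomorphic_g.zero_outside _ _ h, smul_zero]

theorem holomorphic_toSystem_q (hP : IsOpen P) (hV : IsOpen V) (hE : IsAdmissible P V E) :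
    IsHolomorphicOffDiagonal P V (E.toSystem P V).q := by
  classical
  refine IsHolomorphicOffDiagonal.of_ite hP hV fun p₁ hp₁ p₂ hp₂ v hv hne => ?_
  have hf := hE.1.localGT.holomorphic_f.jointAnalyticAt hp₁ hp₂ hv hne
  have hg : ∀ p ∈ P, JointAnalyticAt E.g p v := fun p hp =>
    hE.1.localGT.holomorphic_g.jointAnalyticAt hp hv
  have hγ₁ := (hE.jointAnalyticAt_scale hp₁ hv).comp_first (p₂ := p₂)
  have hγ₂ := (hE.jointAnalyticAt_scale hp₂ hv).comp_second (p₁ := p₁)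
  have hd : AnalyticAt ℂ (fun x : ℂ × ℂ × Fields m =>
      fderiv ℂ (fun u => E.g x.2.1 u 0) x.2.2 (E.g x.1 x.2.2)) (p₁, p₂, v) :=
    (JointAnalyticAt.comp_second (φ := fun p v => fderiv ℂ (fun u => E.g p u 0) v)
      (hE.jointAnalyticAt_scale hp₂ hv).fderiv_analyticAt).clm_apply (hg p₁ hp₁).comp_first
  exact ((analyticAt_const.mul hf.dp₂).div hγ₁ (hE.2 p₁ hp₁ v hv)).add
    (((AnalyticAt.mul hf ((hg p₂ hp₂).dp.component 0).comp_second).add hd).div (hγ₁.mul hγ₂)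
      (mul_ne_zero (hE.2 p₁ hp₁ v hv) (hE.2 p₂ hp₂ v hv)))

theorem isScale (hE : IsAdmissible P V E) :
    (E.toSystem P V).IsScale (fun p v => E.g p v 0) P V where
  analytic := fun p hp v hv => hE.jointAnalyticAt_scale hp hv
  ne_zero := hE.2
  q_eq := fun p₁ hp₁ p₂ hp₂ v hv hne => by
    have hf2 : dp₂ (E.toSystem P V).f p₁ p₂ v = dp₂ E.f p₁ p₂ v / E.g p₁ v 0 := by
      simp only [dp₂, hE.toSystem_f, deriv_div_const]
    have n₁ := hE.2 p₁ hp₁ v hv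
    have n₂ := hE.2 p₂ hp₂ v hv
    rw [hf2, hE.toSystem_f, hE.toSystem_g, map_smul,
      GTSystem.dp_apply (hE.1.localGT.holomorphic_g.jointAnalyticAt hp₂ hv)]
    simp only [GTData.toSystem, smul_eq_mul, alongField]
    rw [if_pos ⟨hp₁, hp₂, hv, hne⟩]
    field_simp

theorem isGibbonsTsarev (hP : IsOpen P) (hV : IsOpen V) (hE : IsAdmissible P V E) :
    IsGibbonsTsarev P V (E.toSystem P V) where
  holomorphic_f := hE.holomorphic_toSystem_f hP hV
  holomorphic_g := hE.holomorphic_toSystem_g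
  holomorphic_q := hE.holomorphic_toSystem_q hP hV
  g_zero := fun p hp v hv => by
    rw [hE.toSystem_g, Pi.smul_apply, smul_eq_mul, inv_mul_cancel₀ (hE.2 p hp v hv)]
  pole_f := by
    obtain ⟨e, he, hfe, hee⟩ := hE.1.localGT.pole_f
    refine ⟨fun p v => 1 / E.g p v 0, ⟨fun p₁ p₂ v => e p₁ p₂ v / E.g p₁ v 0, ?_, ?_, ?_⟩,
      fun p hp v hv => one_div_ne_zero (hE.2 p hp v hv)⟩
    · rintro ⟨p₁, p₂, v⟩ hx
      exact (he _ hx).div (hE.jointAnalyticAt_scale hx.1 hx.2.2).comp_first (hE.2 _ hx.1 _ hx.2.2)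
    · intro p₁ hp₁ p₂ hp₂ v hv hne
      rw [hE.toSystem_f, hfe p₁ hp₁ p₂ hp₂ v hv hne, div_right_comm]
    · intro p hp v hv
      simp only [hee p hp v hv]
  compatible := by
    have hf := hE.holomorphic_toSystem_f hP hV
    have hg := hE.holomorphic_toSystem_g
    have hq := hE.holomorphic_toSystem_q hP hV
    have h₁ : ∀ p₁ ∈ P, ∀ p₂ ∈ P, ∀ v ∈ V, p₁ ≠ p₂ →
        (E.toSystem P V).mixedFields p₁ p₂ v = (E.toSystem P V).mixedFields p₂ p₁ v :=
      fun p₁ hp₁ p₂ hp₂ v hv hne => (hE.isScale.bracket_iff hf hg hp₁ hp₂ hv hne hE.eq_rescale).1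
        (hE.1.localGT.bracket p₁ hp₁ p₂ hp₂ v hv hne)
    have h₂ : ∀ p₁ ∈ P, ∀ p₂ ∈ P, ∀ p₃ ∈ P, ∀ v ∈ V, p₁ ≠ p₂ → p₁ ≠ p₃ → p₂ ≠ p₃ →
        (E.toSystem P V).mixedPoint p₁ p₂ p₃ v = (E.toSystem P V).mixedPoint p₂ p₁ p₃ v :=
      fun p₁ hp₁ p₂ hp₂ p₃ hp₃ v hv h12 h13 h23 =>
        (hE.isScale.jacobi_iff hf hp₁ hp₂ hp₃ hv h12 h13 h23 hE.eq_rescale).1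
        (hE.1.localGT.jacobi p₁ hp₁ p₂ hp₂ p₃ hp₃ v hv h12 h13 h23)
    exact GTSystem.compatible_of_symm hf hg hq h₁ h₂
      fun p₁ hp₁ p₂ hp₂ p₃ hp₃ v hv h12 h13 h23 =>
        hE.isScale.mixedWeight_symm hP hV hf hg hq h₁ h₂ hp₁ hp₂ hp₃ hv h12 h13 h23

theorem integrableBy (hP : IsOpen P) (hV : IsOpen V) (hE : IsAdmissible P V E)
    {H : Set (ℂ → Fields m → ℂ)} (hH : H ⊆ potentials P V E) :
    IntegrableBy P V (E.toSystem P V) H where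
  gibbonsTsarev := hE.isGibbonsTsarev hP hV
  holomorphic := fun h hh => (hH hh).1
  reduction := by
    intro h₁ H₁ h₂ H₂ h₃ H₃ M x hx ρ z hz
    simp only [reducedFlow]
    rw [whithamForm_sum]
    refine Finset.sum_eq_zero fun k _ => ?_
    have h1 := (isCharacteristic_of_subset_potentials hP hH (hx.1 k) hx.2.2).smul
      (ρ k * x.2.2 k * (E.g (x.1 k) x.2.1 0)⁻¹) h₁ H₁ h₂ H₂ h₃ H₃ z hz
    simpa only [GTSystem.velocity_fields, hE.toSystem_g, smul_smul, mul_assoc] using h1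
  commute := by
    intro h₀ H₀ h₁ H₁ h₂ H₂ M x hx k l hkl hk hl
    have hne : x.1 l ≠ x.1 k := hx.2.1.ne hkl.symm
    have a : ∀ {h}, h ∈ H → JointAnalyticAt h (x.1 k) x.2.1 := fun hh =>
      (hH hh).1.jointAnalyticAt (hx.1 k) hx.2.2
    -- The term with `h''` cancels: `∂_l h'(p_k)` is a combination of `h'(p_l)` and `h'(p_k)` with
    -- coefficients independent of `h`. Hence `∂_l μ^k` is a factor common to all `h` times `μ^l -
    -- μ^k`.
    have d : ∀ {h}, h ∈ H → fderiv ℂ (dp h (x.1 k)) x.2.1 (E.g (x.1 l) x.2.1) = _ := fun hh =>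
      (hH hh).fderiv_dp_eq hP hE.1.localGT.holomorphic_f hE.1.holomorphic_lam
        (hx.1 l) (hx.1 k) hx.2.2 hne
    rw [GTSystem.D_charVelocity _ (a H₁) (a H₀) hk hkl, GTSystem.D_charVelocity _ (a H₂) (a H₀) hk hkl,
      hE.toSystem_f, hE.toSystem_g]
    simp only [map_smul, smul_eq_mul, d H₀, d H₁, d H₂, charVelocity]
    have n := hE.2 _ (hx.1 l) _ hx.2.2
    field_simp
    ring

end IsAdmissible

end Forward

/-! ### Generic independence of the derivatives of potentials. -/

section Generic

variable {m : ℕ} {P : Set ℂ} {V : Set (Fields m)} {H : Set (ℂ → Fields m → ℂ)}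

theorem JointAnalyticAt.left {F : Type*} [NormedAddCommGroup F] [NormedSpace ℂ F]
    {φ : ℂ → Fields m → F} {p : ℂ} {v : Fields m} (h : JointAnalyticAt φ p v) :
    AnalyticAt ℂ (fun z => φ z v) p :=
  AnalyticAt.comp (f := fun z : ℂ => (z, v)) (x := p) h (by fun_prop)

/-- The minor of the derivatives of two potentials at the points `z` and `p`. -/
noncomputable def derivMinor (h₁ h₂ : ℂ → Fields m → ℂ) (p z : ℂ) (v : Fields m) : ℂ :=
  dp h₁ z v * dp h₂ p v - dp h₂ z v * dp h₁ p v

/-- The determinant of `h'(z)`, `h''(z)`, `h'(p)` for three potentials. -/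
noncomputable def derivWronskian (h : Fin 3 → ℂ → Fields m → ℂ) (p z : ℂ) (v : Fields m) : ℂ :=
  (dp (h 1) z v * dp (dp (h 2)) z v - dp (h 2) z v * dp (dp (h 1)) z v) * dp (h 0) p v
    + (dp (h 2) z v * dp (dp (h 0)) z v - dp (h 0) z v * dp (dp (h 2)) z v) * dp (h 1) p v
    + (dp (h 0) z v * dp (dp (h 1)) z v - dp (h 1) z v * dp (dp (h 0)) z v) * dp (h 2) p v

/-- Otherwise the expansion of the determinant along its last row vanishes. -/
theorem exists_derivMinor_ne_zero {h : Fin 3 → ℂ → Fields m → ℂ} {v : Fields m} {z : Fin 3 → ℂ}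
    (hz : ∀ b, z b ∈ P) (hdet : (Matrix.of fun a b => dp (h a) (z b) v).det ≠ 0) :
    ∃ p ∈ P, ∃ w ∈ P, derivMinor (h 0) (h 1) p w v ≠ 0 := by
  by_contra! hcon
  apply hdet
  have h01 := hcon _ (hz 0) _ (hz 1)
  have h02 := hcon _ (hz 0) _ (hz 2)
  have h12 := hcon _ (hz 1) _ (hz 2)
  rw [Matrix.det_fin_three]
  simp only [derivMinor, Matrix.of_apply] at *
  linear_combination -dp (h 2) (z 2) v * h01 + dp (h 2) (z 1) v * h02 - dp (h 2) (z 0) v * h12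

/-- `b / a` is constant near `y`, and the identity theorem carries the proportionality past the
zeros of `a`. -/
theorem eq_const_mul_of_wronskian_eq_zero (hPo : IsOpen P) (hPc : IsPreconnected P) {a b : ℂ → ℂ}
    (ha : AnalyticOnNhd ℂ a P) (hb : AnalyticOnNhd ℂ b P)
    (hW : ∀ z ∈ P, a z * deriv b z = b z * deriv a z) {y : ℂ} (hy : y ∈ P) (hay : a y ≠ 0) :
    ∃ c : ℂ, ∀ z ∈ P, b z = c * a z := by
  obtain ⟨ε, hε, hball⟩ : ∃ ε > 0, Metric.ball y ε ⊆ {z | z ∈ P ∧ a z ≠ 0} :=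
    Metric.mem_nhds_iff.1 (Filter.inter_mem (hPo.mem_nhds hy) ((ha y hy).continuousAt.eventually_ne hay))
  have hd : ∀ z ∈ Metric.ball y ε, HasDerivAt (fun z => b z / a z) 0 z := by
    intro z hz
    obtain ⟨hzP, hza⟩ := hball hz
    refine ((hb z hzP).differentiableAt.hasDerivAt.fun_div
      (ha z hzP).differentiableAt.hasDerivAt hza).congr_deriv ?_
    rw [div_eq_zero_iff]
    left
    linear_combination hW z hzP
  have hconst : ∀ z ∈ Metric.ball y ε, b z / a z = b y / a y := fun z hz =>
    Metric.isOpen_ball.is_const_of_deriv_eq_zero (convex_ball y ε).isPreconnected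
      (fun w hw => (hd w hw).differentiableAt.differentiableWithinAt)
      (fun w hw => (hd w hw).deriv) hz (Metric.mem_ball_self hε)
  refine ⟨b y / a y, fun z hz => ?_⟩
  have h0 : (fun z => b z - b y / a y * a z) =ᶠ[𝓝 y] 0 := by
    filter_upwards [Metric.ball_mem_nhds y hε] with w hw
    rw [← hconst w hw, div_mul_cancel₀ _ (hball hw).2, sub_self]
    rfl
  exact sub_eq_zero.1 ((hb.sub (analyticOnNhd_const.mul ha)).eqOn_zero_of_preconnected_of_eventuallyEq_zero
    hPc hy h0 hz)

/-- The vectors `h'(z_b)` span, so identical vanishing would force the cross product of `h'(w)` and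
`h''(w)` to be zero at every `w`. Then `h₁'` would be a constant multiple of `h₀'`, contradicting
`hdet`. -/
theorem exists_derivWronskian_ne_zero (hPo : IsOpen P) (hPc : IsPreconnected P)
    {h : Fin 3 → ℂ → Fields m → ℂ} {v : Fields m} {z : Fin 3 → ℂ}
    (hh : ∀ a, ∀ p ∈ P, JointAnalyticAt (h a) p v)
    (hz : ∀ b, z b ∈ P) (hdet : (Matrix.of fun a b => dp (h a) (z b) v).det ≠ 0) :
    ∃ p ∈ P, ∃ w ∈ P, derivWronskian h p w v ≠ 0 := by
  by_contra! hcon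
  have hW : ∀ w ∈ P, dp (h 0) w v * dp (dp (h 1)) w v = dp (h 1) w v * dp (dp (h 0)) w v := by
    intro w hw
    refine mul_right_cancel₀ hdet ?_
    have e0 := hcon _ (hz 0) _ hw
    have e1 := hcon _ (hz 1) _ hw
    have e2 := hcon _ (hz 2) _ hw
    rw [Matrix.det_fin_three]
    simp only [derivWronskian, Matrix.of_apply] at *
    linear_combination
      (dp (h 0) (z 1) v * dp (h 1) (z 2) v - dp (h 0) (z 2) v * dp (h 1) (z 1) v) * e0
      + (dp (h 0) (z 2) v * dp (h 1) (z 0) v - dp (h 0) (z 0) v * dp (h 1) (z 2) v) * e1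
      + (dp (h 0) (z 0) v * dp (h 1) (z 1) v - dp (h 0) (z 1) v * dp (h 1) (z 0) v) * e2
  obtain ⟨y, hy, hy0⟩ : ∃ y ∈ P, dp (h 0) y v ≠ 0 := by
    by_contra! h0
    apply hdet
    rw [Matrix.det_fin_three]
    simp [h0 _ (hz 0), h0 _ (hz 1), h0 _ (hz 2)]
  obtain ⟨c, hc⟩ := eq_const_mul_of_wronskian_eq_zero hPo hPc
    (fun z hz => (hh 0 z hz).dp.left) (fun z hz => (hh 1 z hz).dp.left) hW hy hy0
  apply hdet
  rw [Matrix.det_fin_three]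
  simp only [Matrix.of_apply, hc _ (hz 0), hc _ (hz 1), hc _ (hz 2)]
  ring

theorem derivMinor_analyticOnNhd {h₁ h₂ : ℂ → Fields m → ℂ} (hh₁ : IsHolomorphic P V h₁)
    (hh₂ : IsHolomorphic P V h₂) :
    AnalyticOnNhd ℂ (fun x : ℂ × ℂ × Fields m => derivMinor h₁ h₂ x.1 x.2.1 x.2.2)
      (P ×ˢ P ×ˢ V) := by
  rintro ⟨p, z, v⟩ ⟨hp, hz, hv⟩
  exact ((hh₁.jointAnalyticAt hz hv).dp.comp_second.mul
      (hh₂.jointAnalyticAt hp hv).dp.comp_first).sub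
    ((hh₂.jointAnalyticAt hz hv).dp.comp_second.mul (hh₁.jointAnalyticAt hp hv).dp.comp_first)

theorem derivWronskian_analyticOnNhd {h : Fin 3 → ℂ → Fields m → ℂ}
    (hh : ∀ a, IsHolomorphic P V (h a)) :
    AnalyticOnNhd ℂ (fun x : ℂ × ℂ × Fields m => derivWronskian h x.1 x.2.1 x.2.2)
      (P ×ˢ P ×ˢ V) := by
  rintro ⟨p, z, v⟩ ⟨hp, hz, hv⟩
  have a := fun i => ((hh i).jointAnalyticAt hz hv).dp.comp_second (p₁ := p)
  have s := fun i => ((hh i).jointAnalyticAt hz hv).dp.dp.comp_second (p₁ := p)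
  have c := fun i => ((hh i).jointAnalyticAt hp hv).dp.comp_first (p₂ := z)
  exact (((((a 1).mul (s 2)).sub ((a 2).mul (s 1))).mul (c 0)).add
    ((((a 2).mul (s 0)).sub ((a 0).mul (s 2))).mul (c 1))).add
    ((((a 0).mul (s 1)).sub ((a 1).mul (s 0))).mul (c 2))

end Generic

/-! ### The linear conditions on potentials imposed by reductions. -/

section Backward

variable {m : ℕ} {P : Set ℂ} {V : Set (Fields m)} {S : GTSystem m} {H : Set (ℂ → Fields m → ℂ)}

/-- One-component reductions already suffice: this is the vanishing determinant of the rows `h'(z)`,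
`ĝ(p)(h(z))`, `h'(p)`. -/
theorem IntegrableBy.reduction_det (hI : IntegrableBy P V S H) {h₁ h₂ h₃ : ℂ → Fields m → ℂ}
    (H₁ : h₁ ∈ H) (H₂ : h₂ ∈ H) (H₃ : h₃ ∈ H) {p z : ℂ} {v : Fields m} (hp : p ∈ P) (hz : z ∈ P)
    (hv : v ∈ V) :
    (dp h₁ z v * fderiv ℂ (h₂ z) v (S.g p v) - dp h₂ z v * fderiv ℂ (h₁ z) v (S.g p v)) * dp h₃ p v
    + (dp h₂ z v * fderiv ℂ (h₃ z) v (S.g p v) - dp h₃ z v * fderiv ℂ (h₂ z) v (S.g p v))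
      * dp h₁ p v
    + (dp h₃ z v * fderiv ℂ (h₁ z) v (S.g p v) - dp h₁ z v * fderiv ℂ (h₃ z) v (S.g p v))
      * dp h₂ p v = 0 := by
  have h := hI.reduction h₁ H₁ h₂ H₂ h₃ H₃ 1 (fun _ => p, v, fun _ => 1)
    ⟨fun _ => hp, Function.injective_of_subsingleton _, hv⟩ (fun _ => 1) z hz
  simp only [whithamForm, reducedFlow, GTSystem.velocity_fields, Finset.univ_unique,
    Finset.sum_singleton, map_smul, smul_eq_mul] at h
  linear_combination h

theorem IntegrableBy.reduction_det_deriv (hPo : IsOpen P) (hI : IntegrableBy P V S H)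
    {h₁ h₂ h₃ : ℂ → Fields m → ℂ}
    (H₁ : h₁ ∈ H) (H₂ : h₂ ∈ H) (H₃ : h₃ ∈ H) {p z : ℂ} {v : Fields m} (hp : p ∈ P) (hz : z ∈ P)
    (hv : v ∈ V) :
    (dp (dp h₁) z v * fderiv ℂ (h₂ z) v (S.g p v) + dp h₁ z v * fderiv ℂ (dp h₂ z) v (S.g p v)
      - (dp (dp h₂) z v * fderiv ℂ (h₁ z) v (S.g p v)
        + dp h₂ z v * fderiv ℂ (dp h₁ z) v (S.g p v))) * dp h₃ p v
    + (dp (dp h₂) z v * fderiv ℂ (h₃ z) v (S.g p v) + dp h₂ z v * fderiv ℂ (dp h₃ z) v (S.g p v)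
      - (dp (dp h₃) z v * fderiv ℂ (h₂ z) v (S.g p v)
        + dp h₃ z v * fderiv ℂ (dp h₂ z) v (S.g p v))) * dp h₁ p v
    + (dp (dp h₃) z v * fderiv ℂ (h₁ z) v (S.g p v) + dp h₃ z v * fderiv ℂ (dp h₁ z) v (S.g p v)
      - (dp (dp h₁) z v * fderiv ℂ (h₃ z) v (S.g p v)
        + dp h₁ z v * fderiv ℂ (dp h₃ z) v (S.g p v))) * dp h₂ p v = 0 := by
  have a : ∀ {h}, h ∈ H → HasDerivAt (fun y => dp h y v) (dp (dp h) z v) z := fun hh =>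
    ((hI.holomorphic _ hh).jointAnalyticAt hz hv).dp.hasDerivAt_left
  have b : ∀ {h}, h ∈ H → HasDerivAt (fun y => fderiv ℂ (h y) v (S.g p v))
      (fderiv ℂ (dp h z) v (S.g p v)) z := fun hh =>
    ((hI.holomorphic _ hh).jointAnalyticAt hz hv).hasDerivAt_fderiv _
  have hd := (((((a H₁).mul (b H₂)).sub ((a H₂).mul (b H₁))).mul_const (dp h₃ p v)).add
    ((((a H₂).mul (b H₃)).sub ((a H₃).mul (b H₂))).mul_const (dp h₁ p v))).add
    ((((a H₃).mul (b H₁)).sub ((a H₁).mul (b H₃))).mul_const (dp h₂ p v))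
  refine hd.unique ((hasDerivAt_const z (0 : ℂ)).congr_of_eventuallyEq ?_)
  filter_upwards [hPo.mem_nhds hz] with y hy
  exact hI.reduction_det H₁ H₂ H₃ hp hy hv

/-- `Y h` is the derivative of `h'(z)` along the flow of `p` at unit weight. Clearing denominators
turns Tsarev's condition for the two-component reduction into the vanishing determinant of the rows
`h'(z)`, `Y h`, `h'(p)`. -/
theorem IntegrableBy.commute_det (hI : IntegrableBy P V S H) {h₀ h₁ h₂ : ℂ → Fields m → ℂ}
    (H₀ : h₀ ∈ H) (H₁ : h₁ ∈ H) (H₂ : h₂ ∈ H) {p z : ℂ} {v : Fields m} (hp : p ∈ P) (hz : z ∈ P)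
    (hv : v ∈ V) (hne : p ≠ z) (hp0 : dp h₀ p v ≠ 0) (hz0 : dp h₀ z v ≠ 0)
    {Y : (ℂ → Fields m → ℂ) → ℂ}
    (hY : ∀ h, Y h = S.f p z v * dp (dp h) z v + fderiv ℂ (dp h z) v (S.g p v)) :
    dp h₀ z v * (Y h₁ * dp h₂ p v - Y h₂ * dp h₁ p v)
      + dp h₁ z v * (Y h₂ * dp h₀ p v - Y h₀ * dp h₂ p v)
      + dp h₂ z v * (Y h₀ * dp h₁ p v - Y h₁ * dp h₀ p v) = 0 := by
  have hx : ((![z, p], v, fun _ => 1) : Jet m 2) ∈ jetDomain P V 2 := by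
    refine ⟨by simp [Fin.forall_fin_two, hp, hz], ?_, hv⟩
    intro i j
    fin_cases i <;> fin_cases j <;> simp [hne, hne.symm]
  have h := hI.commute h₀ H₀ h₁ H₁ h₂ H₂ 2 _ hx 0 1 (by simp) (by simpa using hz0)
    (by simpa using hp0)
  have a : ∀ {h}, h ∈ H → JointAnalyticAt h z v := fun hh =>
    (hI.holomorphic _ hh).jointAnalyticAt hz hv
  rw [S.D_charVelocity (a H₁) (a H₀) hz0 (by simp), S.D_charVelocity (a H₂) (a H₀) hz0 (by simp)]
    at h
  simp only [charVelocity, Matrix.cons_val_zero, Matrix.cons_val_one, ← hY, one_mul] at h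
  field_simp at h
  apply mul_left_cancel₀ hz0
  linear_combination h

/-- The numerator of `λ`: the quotient of this function of `h` by `h'(p)` does not depend
on `h`. -/
noncomputable def lamNum (S : GTSystem m) (e : ℂ → ℂ → Fields m → ℂ) (h : ℂ → Fields m → ℂ)
    (p z : ℂ) (v : Fields m) : ℂ :=
  (p - z) * fderiv ℂ (h z) v (S.g p v) + e p z v * dp h z v

theorem lamNum_analyticAt {e : ℂ → ℂ → Fields m → ℂ} {h : ℂ → Fields m → ℂ}
    (hg : IsHolomorphic P V S.g) (hh : IsHolomorphic P V h) {p z : ℂ} {v : Fields m} (hp : p ∈ P)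
    (hz : z ∈ P) (hv : v ∈ V) (he : JointAnalyticAt₂ e p z v) :
    JointAnalyticAt₂ (lamNum S e h) p z v := by
  have hb : AnalyticAt ℂ (fun x : ℂ × ℂ × Fields m => fderiv ℂ (h x.2.1) x.2.2 (S.g x.1 x.2.2))
      (p, z, v) :=
    (JointAnalyticAt.comp_second (φ := fun p v => fderiv ℂ (h p) v)
      (hh.jointAnalyticAt hz hv).fderiv_analyticAt).clm_apply (hg.jointAnalyticAt hp hv).comp_first
  have hd : AnalyticAt ℂ (fun x : ℂ × ℂ × Fields m => x.1 - x.2.1) (p, z, v) := by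
    have := (ContinuousLinearMap.fst ℂ ℂ (ℂ × Fields m) - (ContinuousLinearMap.fst ℂ ℂ (Fields m)).comp
      (ContinuousLinearMap.snd ℂ ℂ (ℂ × Fields m))).analyticAt (p, z, v)
    exact this
  exact (hd.mul hb).add (AnalyticAt.mul he (hh.jointAnalyticAt hz hv).dp.comp_second)

/-- Put `a = h'(z)`, `s = h''(z)`, `c = h'(p)`, `b = ĝ(p)(h(z))`. The reduction gives `det(a, b + f̂
a, c) = 0`; its `z`-derivative minus commutativity gives `det(s, b + f̂ a, c) = 0`. Since `a, s, c`
are independent, `b + f̂ a` is a multiple of `c`. -/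
theorem IntegrableBy.lamNum_triple (hPo : IsOpen P) (hI : IntegrableBy P V S H)
    {e : ℂ → ℂ → Fields m → ℂ}
    (hf : ∀ p₁ ∈ P, ∀ p₂ ∈ P, ∀ v ∈ V, p₁ ≠ p₂ → S.f p₁ p₂ v = e p₁ p₂ v / (p₁ - p₂))
    {h : Fin 3 → ℂ → Fields m → ℂ} (hH : ∀ a, h a ∈ H) {p z : ℂ} {v : Fields m}
    (hp : p ∈ P) (hz : z ∈ P) (hv : v ∈ V) (hp0 : dp (h 0) p v ≠ 0) (hz0 : dp (h 0) z v ≠ 0)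
    (hW : derivWronskian h p z v ≠ 0) :
    lamNum S e (h 0) p z v * dp (h 1) p v = lamNum S e (h 1) p z v * dp (h 0) p v := by
  -- At `p = z` two rows of the determinant coincide.
  have hne : p ≠ z := by
    rintro rfl
    apply hW
    simp only [derivWronskian]
    ring
  have he : e p z v = (p - z) * S.f p z v := by
    rw [hf p hp z hz v hv hne, mul_div_cancel₀ _ (sub_ne_zero.2 hne)]
  have r := hI.reduction_det (hH 0) (hH 1) (hH 2) hp hz hv
  have r' := hI.reduction_det_deriv hPo (hH 0) (hH 1) (hH 2) hp hz hv
  have c := hI.commute_det (hH 0) (hH 1) (hH 2) hp hz hv hne hp0 hz0 (fun _ => rfl)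
  simp only [lamNum, he]
  refine mul_left_cancel₀ hW ?_
  simp only [derivWronskian]
  clear hW hz0 hp0 he
  generalize fderiv ℂ (h 0 z) v (S.g p v) = b0 at *
  generalize fderiv ℂ (h 1 z) v (S.g p v) = b1 at *
  generalize fderiv ℂ (h 2 z) v (S.g p v) = b2 at *
  generalize fderiv ℂ (dp (h 0) z) v (S.g p v) = t0 at *
  generalize fderiv ℂ (dp (h 1) z) v (S.g p v) = t1 at *
  generalize fderiv ℂ (dp (h 2) z) v (S.g p v) = t2 at *
  generalize dp (dp (h 0)) z v = s0 at *
  generalize dp (dp (h 1)) z v = s1 at *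
  generalize dp (dp (h 2)) z v = s2 at *
  generalize dp (h 0) z v = a0 at *
  generalize dp (h 1) z v = a1 at *
  generalize dp (h 2) z v = a2 at *
  generalize dp (h 0) p v = c0 at *
  generalize dp (h 1) p v = c1 at *
  generalize dp (h 2) p v = c2 at *
  generalize S.f p z v = f at *
  linear_combination (p - z) * (s0 * c1 - s1 * c0) * r + (p - z) * (c0 * a1 - c1 * a0) * (r' - c)

end Backward

/-! ### Proportionality of `lamNum` to `h'(p)` for all potentials, at all points. -/

section Proportionality

variable {m : ℕ} {P : Set ℂ} {V : Set (Fields m)} {S : GTSystem m} {H : Set (ℂ → Fields m → ℂ)}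

theorem isPreconnected_triples (hPc : IsPreconnected P) (hVc : IsPreconnected V) :
    IsPreconnected (P ×ˢ P ×ˢ V) :=
  hPc.prod (hPc.prod hVc)

theorem isOpen_triples (hPo : IsOpen P) (hVo : IsOpen V) : IsOpen (P ×ˢ P ×ˢ V) :=
  hPo.prod (hPo.prod hVo)

theorem dp_first_analyticOnNhd {h : ℂ → Fields m → ℂ} (hh : IsHolomorphic P V h) :
    AnalyticOnNhd ℂ (fun x : ℂ × ℂ × Fields m => dp h x.1 x.2.2) (P ×ˢ P ×ˢ V) := by
  rintro ⟨p, z, v⟩ ⟨hp, hz, hv⟩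
  exact (hh.jointAnalyticAt hp hv).dp.comp_first

theorem dp_second_analyticOnNhd {h : ℂ → Fields m → ℂ} (hh : IsHolomorphic P V h) :
    AnalyticOnNhd ℂ (fun x : ℂ × ℂ × Fields m => dp h x.2.1 x.2.2) (P ×ˢ P ×ˢ V) := by
  rintro ⟨p, z, v⟩ ⟨hp, hz, hv⟩
  exact (hh.jointAnalyticAt hz hv).dp.comp_second

theorem IntegrableBy.lamNum_mul_eq (hPo : IsOpen P) (hPc : IsPreconnected P) (hVo : IsOpen V)
    (hVc : IsPreconnected V) (hI : IntegrableBy P V S H) (hN : Nondegenerate P V H)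
    {e : ℂ → ℂ → Fields m → ℂ}
    (he : AnalyticOnNhd ℂ (fun x : ℂ × ℂ × Fields m => e x.1 x.2.1 x.2.2) (P ×ˢ P ×ˢ V))
    (hf : ∀ p₁ ∈ P, ∀ p₂ ∈ P, ∀ v ∈ V, p₁ ≠ p₂ → S.f p₁ p₂ v = e p₁ p₂ v / (p₁ - p₂))
    {h₁ h₂ : ℂ → Fields m → ℂ} (H₁ : h₁ ∈ H) (H₂ : h₂ ∈ H) :
    ∀ x ∈ P ×ˢ P ×ˢ V, lamNum S e h₁ x.1 x.2.1 x.2.2 * dp h₂ x.1 x.2.2 =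
      lamNum S e h₂ x.1 x.2.1 x.2.2 * dp h₁ x.1 x.2.2 := by
  obtain ⟨-, T, hT, v₀, hv₀, ζ, hζ, hdet⟩ := hN
  have hU := isPreconnected_triples hPc hVc
  have hUo := isOpen_triples hPo hVo
  have hol := hI.holomorphic
  have hD := derivMinor_analyticOnNhd (hol _ (hT 0)) (hol _ (hT 1))
  have hW := derivWronskian_analyticOnNhd fun a => hol _ (hT a)
  obtain ⟨p₀, hp₀, w₀, hw₀, hD0⟩ := exists_derivMinor_ne_zero hζ hdet
  obtain ⟨p₁, hp₁, w₁, hw₁, hW0⟩ := exists_derivWronskian_ne_zero hPo hPc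
    (fun a p hp => (hol _ (hT a)).jointAnalyticAt hp hv₀) hζ hdet
  obtain ⟨y, hy, hy0⟩ : ∃ y ∈ P, dp (T 0) y v₀ ≠ 0 := by
    by_contra! h0
    apply hD0
    simp [derivMinor, h0 _ hp₀, h0 _ hw₀]
  have hc := dp_first_analyticOnNhd (hol _ (hT 0))
  have ha := dp_second_analyticOnNhd (hol _ (hT 0))
  have hy' : (y, y, v₀) ∈ P ×ˢ P ×ˢ V := ⟨hy, hy, hv₀⟩
  -- One analytic function collects the three non-vanishing conditions of `lamNum_triple`.
  obtain ⟨x₁, hx₁, h1⟩ := exists_mul_ne_zero hUo hU (hc.mul ha) hW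
    (exists_mul_ne_zero hUo hU hc ha ⟨_, hy', hy0⟩ ⟨_, hy', hy0⟩)
    ⟨(p₁, w₁, v₀), ⟨hp₁, hw₁, hv₀⟩, hW0⟩
  have cont : ∀ {h k : ℂ → Fields m → ℂ}, h ∈ H → k ∈ H → ∀ x ∈ P ×ˢ P ×ˢ V, ContinuousAt
      (fun x : ℂ × ℂ × Fields m => lamNum S e h x.1 x.2.1 x.2.2 * dp k x.1 x.2.2) x := by
    rintro h k hh hk ⟨p, z, v⟩ hx
    exact ((lamNum_analyticAt hI.gibbonsTsarev.holomorphic_g (hol _ hh) hx.1 hx.2.1 hx.2.2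
      (he _ hx)).continuousAt).mul (dp_first_analyticOnNhd (hol _ hk) _ hx).continuousAt
  have step1 : ∀ x ∈ P ×ˢ P ×ˢ V, lamNum S e (T 0) x.1 x.2.1 x.2.2 * dp (T 1) x.1 x.2.2 =
      lamNum S e (T 1) x.1 x.2.1 x.2.2 * dp (T 0) x.1 x.2.2 := by
    intro x hx
    rw [← sub_eq_zero]
    refine eq_zero_of_continuousAt_of_forall_ne_zero ((hc.mul ha).mul hW) hU hx₁ h1 hx
      (G := fun x => lamNum S e (T 0) x.1 x.2.1 x.2.2 * dp (T 1) x.1 x.2.2 -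
        lamNum S e (T 1) x.1 x.2.1 x.2.2 * dp (T 0) x.1 x.2.2)
      ((cont (hT 0) (hT 1) x hx).sub (cont (hT 1) (hT 0) x hx)) ?_
    filter_upwards [hUo.mem_nhds hx] with w hw hne
    have h2 := mul_ne_zero_iff.1 hne
    have h3 := mul_ne_zero_iff.1 h2.1
    exact sub_eq_zero.2 (hI.lamNum_triple hPo hf hT hw.1 hw.2.1 hw.2.2 h3.1 h3.2 h2.2)
  -- For an arbitrary `h` no new Wronskian is needed: the reduction for `h, T 0, T 1` with `step1`
  -- determines `lamNum` of `h` wherever the minor of `T 0, T 1` is non-zero.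
  have step2 : ∀ h ∈ H, ∀ x ∈ P ×ˢ P ×ˢ V, lamNum S e (T 0) x.1 x.2.1 x.2.2 * dp h x.1 x.2.2 =
      lamNum S e h x.1 x.2.1 x.2.2 * dp (T 0) x.1 x.2.2 := by
    intro h hh x hx
    rw [← sub_eq_zero]
    refine eq_zero_of_continuousAt_of_forall_ne_zero hD hU
      (x₀ := (p₀, w₀, v₀)) ⟨hp₀, hw₀, hv₀⟩ hD0 hx
      (G := fun x => lamNum S e (T 0) x.1 x.2.1 x.2.2 * dp h x.1 x.2.2 -
        lamNum S e h x.1 x.2.1 x.2.2 * dp (T 0) x.1 x.2.2)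
      ((cont (hT 0) hh x hx).sub (cont hh (hT 0) x hx)) ?_
    filter_upwards [hUo.mem_nhds hx] with w hw hne
    refine (mul_eq_zero.1 (?_ : derivMinor (T 0) (T 1) w.1 w.2.1 w.2.2 * _ = 0)).resolve_left hne
    have r := hI.reduction_det hh (hT 0) (hT 1) hw.1 hw.2.1 hw.2.2
    have s1 := step1 w hw
    simp only [lamNum, derivMinor] at s1 ⊢
    linear_combination dp (T 0) w.1 w.2.2 * (w.1 - w.2.1) * r
      - (dp h w.2.1 w.2.2 * dp (T 0) w.1 w.2.2 - dp (T 0) w.2.1 w.2.2 * dp h w.1 w.2.2) * s1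
  intro x hx
  rw [← sub_eq_zero]
  refine eq_zero_of_continuousAt_of_forall_ne_zero hc hU hy' hy0 hx
    (G := fun x => lamNum S e h₁ x.1 x.2.1 x.2.2 * dp h₂ x.1 x.2.2 -
      lamNum S e h₂ x.1 x.2.1 x.2.2 * dp h₁ x.1 x.2.2)
    ((cont H₁ H₂ x hx).sub (cont H₂ H₁ x hx)) ?_
  filter_upwards [hUo.mem_nhds hx] with w hw hne
  refine mul_left_cancel₀ hne ?_
  linear_combination dp h₁ w.1 w.2.2 * step2 h₂ H₂ w hw - dp h₂ w.1 w.2.2 * step2 h₁ H₁ w hw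

end Proportionality

/-! ### The residue of `f̂` on the diagonal determines `q`. -/

section Residue

variable {m : ℕ} {P : Set ℂ} {V : Set (Fields m)} {S : GTSystem m}

theorem JointAnalyticAt₂.diagonal {e : ℂ → ℂ → Fields m → ℂ} {p : ℂ} {v : Fields m}
    (h : JointAnalyticAt₂ e p p v) : JointAnalyticAt (fun p v => e p p v) p v :=
  AnalyticAt.comp (f := fun x : ℂ × Fields m => (x.1, x.1, x.2)) (x := (p, v)) h
    (((ContinuousLinearMap.fst ℂ ℂ (Fields m)).prod (ContinuousLinearMap.id ℂ (ℂ × Fields m))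
      ).analyticAt _)

theorem JointAnalyticAt₂.dp_diagonal {e : ℂ → ℂ → Fields m → ℂ} {p : ℂ} {v : Fields m}
    (h : JointAnalyticAt₂ e p p v) :
    dp (fun p v => e p p v) p v = _root_.dp₁ e p p v + _root_.dp₂ e p p v := by
  have := (h.hasDerivAt_comp (a := fun z => z) (b := fun z => z) (c := fun _ => v) (t := p)
    (hasDerivAt_id' p) (hasDerivAt_id' p) (hasDerivAt_const _ _)).deriv
  exact this.trans (by simp)

theorem GTSystem.IsScale.congr (hPo : IsOpen P) (hVo : IsOpen V) {γ γ' : ℂ → Fields m → ℂ}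
    (h : S.IsScale γ P V) (heq : ∀ p ∈ P, ∀ v ∈ V, γ p v = γ' p v) : S.IsScale γ' P V where
  analytic := fun p hp v hv => by
    refine AnalyticAt.congr (h.analytic p hp v hv) ?_
    filter_upwards [(hPo.prod hVo).mem_nhds (⟨hp, hv⟩ : (p, v) ∈ P ×ˢ V)] with x hx
    exact heq _ hx.1 _ hx.2
  ne_zero := fun p hp v hv => heq p hp v hv ▸ h.ne_zero p hp v hv
  q_eq := fun p₁ hp₁ p₂ hp₂ v hv hne => by
    have h1 : γ p₂ =ᶠ[𝓝 v] γ' p₂ := by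
      filter_upwards [hVo.mem_nhds hv] with u hu using heq _ hp₂ _ hu
    have h2 : (fun z => γ z v) =ᶠ[𝓝 p₂] fun z => γ' z v := by
      filter_upwards [hPo.mem_nhds hp₂] with z hz using heq _ hz _ hv
    have h3 : dp γ p₂ v = dp γ' p₂ v := h2.deriv_eq
    rw [h.q_eq p₁ hp₁ p₂ hp₂ v hv hne, h3, h1.fderiv_eq, heq p₂ hp₂ v hv]

variable {e : ℂ → ℂ → Fields m → ℂ}

/-- Multiply the symmetry of `∂₁∂₂p₃` by `p₂ - p₃` and let `p₃ → p₂`: what remains is the identity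
between residues. -/
theorem IsGibbonsTsarev.q_mul_residue (hPo : IsOpen P) (hVo : IsOpen V)
    (hS : IsGibbonsTsarev P V S)
    (he : AnalyticOnNhd ℂ (fun x : ℂ × ℂ × Fields m => e x.1 x.2.1 x.2.2) (P ×ˢ P ×ˢ V))
    (hf : ∀ p₁ ∈ P, ∀ p₂ ∈ P, ∀ v ∈ V, p₁ ≠ p₂ → S.f p₁ p₂ v = e p₁ p₂ v / (p₁ - p₂))
    {p₁ p₂ : ℂ} {v : Fields m} (hp₁ : p₁ ∈ P) (hp₂ : p₂ ∈ P) (hv : v ∈ V) (hne : p₁ ≠ p₂) :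
    S.q p₁ p₂ v * e p₂ p₂ v = 2 * dp₂ S.f p₁ p₂ v * e p₂ p₂ v
      - S.f p₁ p₂ v * (dp₁ e p₂ p₂ v + dp₂ e p₂ p₂ v)
      - fderiv ℂ (e p₂ p₂) v (S.g p₁ v) := by
  have he' : ∀ a ∈ P, ∀ b ∈ P, JointAnalyticAt₂ e a b v := fun a ha b hb =>
    he (a, b, v) ⟨ha, hb, hv⟩
  have hf1 : ∀ y ∈ P, p₂ ≠ y →
      dp₁ S.f p₂ y v = dp₁ e p₂ y v / (p₂ - y) - e p₂ y v / (p₂ - y) ^ 2 := by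
    intro y hy hy2
    have h0 : p₂ - y ≠ 0 := sub_ne_zero.2 hy2
    have h1 := (he' p₂ hp₂ y hy).hasDerivAt_left.fun_div ((hasDerivAt_id' p₂).sub_const y) h0
    have h2 : (fun z => S.f z y v) =ᶠ[𝓝 p₂] fun z => e z y v / (z - y) := by
      filter_upwards [hPo.mem_nhds hp₂, isOpen_ne.mem_nhds hy2] with z hz hzy
      exact hf z hz y hy v hv hzy
    refine (h1.congr_of_eventuallyEq h2).deriv.trans ?_
    field_simp
  have hf2 : ∀ y ∈ P, p₂ ≠ y →
      dp₂ S.f p₂ y v = dp₂ e p₂ y v / (p₂ - y) + e p₂ y v / (p₂ - y) ^ 2 := by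
    intro y hy hy2
    have h0 : p₂ - y ≠ 0 := sub_ne_zero.2 hy2
    have h1 := (he' p₂ hp₂ y hy).hasDerivAt_right.fun_div ((hasDerivAt_id' y).const_sub p₂) h0
    have h2 : (fun z => S.f p₂ z v) =ᶠ[𝓝 y] fun z => e p₂ z v / (p₂ - z) := by
      filter_upwards [hPo.mem_nhds hy, isOpen_ne.mem_nhds hy2.symm] with z hz hzy
      exact hf p₂ hp₂ z hz v hv (Ne.symm hzy)
    refine (h1.congr_of_eventuallyEq h2).deriv.trans ?_
    field_simp
    ring
  have hf3 : ∀ y ∈ P, p₂ ≠ y → ∀ X,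
      fderiv ℂ (S.f p₂ y) v X = fderiv ℂ (e p₂ y) v X / (p₂ - y) := by
    intro y hy hy2 X
    have h2 : S.f p₂ y =ᶠ[𝓝 v] fun u => (p₂ - y)⁻¹ * e p₂ y u := by
      filter_upwards [hVo.mem_nhds hv] with u hu
      rw [hf p₂ hp₂ y hy u hu hy2, div_eq_inv_mul]
    rw [h2.fderiv_eq, fderiv_const_mul (he' p₂ hp₂ y hy).right.differentiableAt]
    simp [div_eq_inv_mul]
  -- The two double poles at `y = p₂` have coefficients `-f(p₁, p₂)` and `f(p₁, y)`, up to the same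
  -- factor. Their sum is a divided difference of `f(p₁, ·)`, and `dslope` extends it continuously
  -- to `y = p₂`.
  set G : ℂ → ℂ := fun y => S.f p₁ p₂ v * dp₁ e p₂ y v + S.f p₁ y v * dp₂ e p₂ y v
    - e p₂ y v * dslope (fun z => S.f p₁ z v) p₂ y + fderiv ℂ (e p₂ y) v (S.g p₁ v)
    + S.q p₁ p₂ v * e p₂ y v
    - (p₂ - y) * (S.f p₂ p₁ v * dp₁ S.f p₁ y v + fderiv ℂ (S.f p₁ y) v (S.g p₂ v)
      + S.q p₂ p₁ v * S.f p₁ y v) - e p₂ y v * dp₂ S.f p₁ y v with hG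
  have f12 := hS.holomorphic_f.jointAnalyticAt hp₁ hp₂ hv hne
  have e22 := he' p₂ hp₂ p₂ hp₂
  have hcont : ContinuousAt G p₂ := by
    have c1 := e22.dp₁.hasDerivAt_right.continuousAt
    have c2 := e22.dp₂.hasDerivAt_right.continuousAt
    have c3 := e22.hasDerivAt_right.continuousAt
    have c4 := (e22.hasDerivAt_right_fderiv (S.g p₁ v)).continuousAt
    have c5 := f12.hasDerivAt_right.continuousAt
    have c6 := continuousAt_dslope_same.2 f12.hasDerivAt_right.differentiableAt
    have c7 := f12.dp₁.hasDerivAt_right.continuousAt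
    have c8 := f12.dp₂.hasDerivAt_right.continuousAt
    have c9 := (f12.hasDerivAt_right_fderiv (S.g p₂ v)).continuousAt
    have c10 : ContinuousAt (fun y : ℂ => p₂ - y) p₂ := by fun_prop
    exact ((((((continuousAt_const.mul c1).add (c5.mul c2)).sub (c3.mul c6)).add c4).add
      (continuousAt_const.mul c3)).sub (c10.mul (((continuousAt_const.mul c7).add c9).add
      (continuousAt_const.mul c5)))).sub (c3.mul c8)
  have hzero : G p₂ = 0 := by
    refine eq_zero_of_punctured hcont ?_
    filter_upwards [hPo.mem_nhds hp₂, isOpen_ne.mem_nhds hne.symm] with y hy hy1 hy2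
    have hm := hS.compatible.mixedPoint_symm hS.holomorphic_f hp₁ hp₂ hy hv hne (Ne.symm hy1)
      (Ne.symm hy2)
    have h0 : p₂ - y ≠ 0 := sub_ne_zero.2 (Ne.symm hy2)
    have h0' : y - p₂ ≠ 0 := sub_ne_zero.2 hy2
    rw [GTSystem.mixedPoint, GTSystem.mixedPoint, hf1 y hy (Ne.symm hy2), hf2 y hy (Ne.symm hy2),
      hf3 y hy (Ne.symm hy2), hf p₂ hp₂ y hy v hv (Ne.symm hy2)] at hm
    have hs : dslope (fun z => S.f p₁ z v) p₂ y = (S.f p₁ p₂ v - S.f p₁ y v) / (p₂ - y) := by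
      rw [dslope_of_ne _ hy2, slope_def_field, div_eq_div_iff h0' h0]
      ring
    simp only [hG, hs]
    field_simp at hm ⊢
    linear_combination hm
  simp only [hG, dslope_same, sub_self, zero_mul] at hzero
  have hd : deriv (fun z => S.f p₁ z v) p₂ = dp₂ S.f p₁ p₂ v := rfl
  rw [hd] at hzero
  linear_combination hzero

/-- The preceding identity divided by the residue; passing to the inverse of the residue changes the
sign of its logarithmic derivative. -/
theorem IsGibbonsTsarev.isScale (hPo : IsOpen P) (hVo : IsOpen V) (hS : IsGibbonsTsarev P V S)
    (he : AnalyticOnNhd ℂ (fun x : ℂ × ℂ × Fields m => e x.1 x.2.1 x.2.2) (P ×ˢ P ×ˢ V))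
    (hf : ∀ p₁ ∈ P, ∀ p₂ ∈ P, ∀ v ∈ V, p₁ ≠ p₂ → S.f p₁ p₂ v = e p₁ p₂ v / (p₁ - p₂))
    (h0 : ∀ p ∈ P, ∀ v ∈ V, e p p v ≠ 0) : S.IsScale (fun p v => (e p p v)⁻¹) P V where
  analytic := fun p hp v hv => AnalyticAt.inv
    (JointAnalyticAt₂.diagonal (he (p, p, v) ⟨hp, hp, hv⟩)) (h0 p hp v hv)
  ne_zero := fun p hp v hv => inv_ne_zero (h0 p hp v hv)
  q_eq := fun p₁ hp₁ p₂ hp₂ v hv hne => by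
    have h1 := hS.q_mul_residue hPo hVo he hf hp₁ hp₂ hv hne
    have e22 : JointAnalyticAt₂ e p₂ p₂ v := he (p₂, p₂, v) ⟨hp₂, hp₂, hv⟩
    have n := h0 p₂ hp₂ v hv
    have hd : dp (fun p v => (e p p v)⁻¹) p₂ v =
        -(dp₁ e p₂ p₂ v + dp₂ e p₂ p₂ v) / e p₂ p₂ v ^ 2 := by
      rw [← e22.dp_diagonal]
      exact (e22.diagonal.hasDerivAt_left.fun_inv n).deriv
    have hfd : fderiv ℂ (fun u => (e p₂ p₂ u)⁻¹) v (S.g p₁ v) =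
        -fderiv ℂ (e p₂ p₂) v (S.g p₁ v) / e p₂ p₂ v ^ 2 := by
      have := ((hasDerivAt_inv n).comp_hasFDerivAt v e22.right.differentiableAt.hasFDerivAt).fderiv
      have h' : fderiv ℂ (fun u => (e p₂ p₂ u)⁻¹) v = _ := this
      rw [h']
      simp
      field_simp
    rw [hd, hfd]
    field_simp
    linear_combination h1

theorem HasDiagonalResidue.unique (hPo : IsOpen P) {φ : ℂ → ℂ → Fields m → ℂ}
    {ρ ρ' : ℂ → Fields m → ℂ} (h : HasDiagonalResidue P V φ ρ) (h' : HasDiagonalResidue P V φ ρ')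
    {p : ℂ} {v : Fields m} (hp : p ∈ P) (hv : v ∈ V) : ρ p v = ρ' p v := by
  obtain ⟨e, he, hφ, hρ⟩ := h
  obtain ⟨e', he', hφ', hρ'⟩ := h'
  rw [← hρ p hp v hv, ← hρ' p hp v hv, ← sub_eq_zero]
  have c1 : JointAnalyticAt₂ e p p v := he (p, p, v) ⟨hp, hp, hv⟩
  have c2 : JointAnalyticAt₂ e' p p v := he' (p, p, v) ⟨hp, hp, hv⟩
  refine eq_zero_of_punctured (G := fun z => e p z v - e' p z v)
    (c1.hasDerivAt_right.continuousAt.sub c2.hasDerivAt_right.continuousAt) ?_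
  filter_upwards [hPo.mem_nhds hp] with z hz hzp
  have h0 : p - z ≠ 0 := sub_ne_zero.2 (Ne.symm hzp)
  have h1 := (hφ p hp z hz v hv (Ne.symm hzp)).symm.trans (hφ' p hp z hz v hv (Ne.symm hzp))
  rw [div_left_inj' h0] at h1
  exact sub_eq_zero.2 h1

end Residue

/-! ### Construction and uniqueness of the enhanced structure. -/

section Potentials

variable {m : ℕ} {P : Set ℂ} {V : Set (Fields m)} {E : GTData m} {H : Set (ℂ → Fields m → ℂ)}

theorem IsPotential.fderiv_fderiv_eq (hVo : IsOpen V) (hf : IsHolomorphicOffDiagonal P V E.f)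
    (hl : IsHolomorphicOffDiagonal P V E.lam) {h : ℂ → Fields m → ℂ}
    (hh : IsPotential P V E h) {p z : ℂ} {v : Fields m} (hp : p ∈ P) (hz : z ∈ P) (hv : v ∈ V)
    (hne : p ≠ z) (X : Fields m) :
    fderiv ℂ (fun u => fderiv ℂ (h z) u (E.g p u)) v X =
      fderiv ℂ (E.lam p z) v X * dp h p v + E.lam p z v * fderiv ℂ (dp h p) v X
        - (fderiv ℂ (E.f p z) v X * dp h z v + E.f p z v * fderiv ℂ (dp h z) v X) := by
  have hev : (fun u => fderiv ℂ (h z) u (E.g p u)) =ᶠ[𝓝 v]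
      fun u => E.lam p z u * dp h p u - E.f p z u * dp h z u := by
    filter_upwards [hVo.mem_nhds hv] with u hu
    exact hh.fderiv_eq hp hz hu hne
  have dl := (hl.jointAnalyticAt hp hz hv hne).right.differentiableAt
  have df := (hf.jointAnalyticAt hp hz hv hne).right.differentiableAt
  have d1 := (hh.1.jointAnalyticAt hp hv).dp.right.differentiableAt
  have d2 := (hh.1.jointAnalyticAt hz hv).dp.right.differentiableAt
  rw [hev.fderiv_eq, fderiv_fun_sub (dl.fun_mul d1) (df.fun_mul d2), fderiv_fun_mul dl d1,
    fderiv_fun_mul df d2]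
  simp
  ring

theorem IsPotential.fderiv_dp_g_eq (hPo : IsOpen P) (hg : IsHolomorphic P V E.g)
    (hf : IsHolomorphicOffDiagonal P V E.f)
    (hl : IsHolomorphicOffDiagonal P V E.lam) {h : ℂ → Fields m → ℂ}
    (hh : IsPotential P V E h) {p z : ℂ} {v : Fields m} (hp : p ∈ P) (hz : z ∈ P) (hv : v ∈ V)
    (hne : p ≠ z) :
    fderiv ℂ (h z) v (dp E.g p v) = dp₁ E.lam p z v * dp h p v + E.lam p z v * dp (dp h) p v
      - dp₁ E.f p z v * dp h z v := by
  have hev : (fun y => fderiv ℂ (h z) v (E.g y v)) =ᶠ[𝓝 p]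
      fun y => E.lam y z v * dp h y v - E.f y z v * dp h z v := by
    filter_upwards [hPo.mem_nhds hp, isOpen_ne.mem_nhds hne] with y hy hyz
    exact hh.fderiv_eq hy hz hv hyz
  have h1 := (fderiv ℂ (h z) v).hasFDerivAt.comp_hasDerivAt p
    (hg.jointAnalyticAt hp hv).hasDerivAt_left
  have h2 := (((hl.jointAnalyticAt hp hz hv hne).hasDerivAt_left.mul
    (hh.1.jointAnalyticAt hp hv).dp.hasDerivAt_left).sub
    ((hf.jointAnalyticAt hp hz hv hne).hasDerivAt_left.mul_const (dp h z v)))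
  exact h1.unique (h2.congr_of_eventuallyEq hev)

/-- The difference of the two sides of the equation for `g(p₁)(λ(p₂, p₃))`. -/
noncomputable def GTData.lamDefect (E : GTData m) (p₁ p₂ p₃ : ℂ) (v : Fields m) : ℂ :=
  fderiv ℂ (E.lam p₂ p₃) v (E.g p₁ v) -
    (E.lam p₁ p₃ v * dp₂ E.lam p₂ p₁ v - E.lam p₂ p₃ v * dp₂ E.f p₁ p₂ v
        - E.f p₁ p₂ v * dp₁ E.lam p₂ p₃ v - E.f p₁ p₃ v * dp₂ E.lam p₂ p₃ v)

/-- Compute `[g(p₁), g(p₂)](h(p₃))` by the bracket relation and by applying the functional equation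
twice. The second derivatives of `h` cancel, the coefficient of `h'(p₃)` is the relation `jacobi`,
and the coefficients of `h'(p₁)` and `h'(p₂)` are the two defects. -/
theorem IsPotential.lamDefect_mul_eq (hPo : IsOpen P) (hVo : IsOpen V)
    (hE : IsLocalGT P V E.g E.f) (hl : IsHolomorphicOffDiagonal P V E.lam)
    {h : ℂ → Fields m → ℂ} (hh : IsPotential P V E h) {p₁ p₂ p₃ : ℂ} {v : Fields m}
    (hp₁ : p₁ ∈ P) (hp₂ : p₂ ∈ P) (hp₃ : p₃ ∈ P) (hv : v ∈ V) (h12 : p₁ ≠ p₂) (h13 : p₁ ≠ p₃)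
    (h23 : p₂ ≠ p₃) :
    E.lamDefect p₁ p₂ p₃ v * dp h p₂ v = E.lamDefect p₂ p₁ p₃ v * dp h p₁ v := by
  have hf := hE.holomorphic_f
  have hg := hE.holomorphic_g
  have comm := VectorField.fderiv_apply_lieBracket (𝕜 := ℂ) (f := h p₃) (V := E.g p₁)
    (W := E.g p₂) (x := v) (n := ⊤)
    ((hh.1.jointAnalyticAt hp₃ hv).right.contDiffAt) (by simp)
    (hg.jointAnalyticAt hp₂ hv).right.differentiableAt
    (hg.jointAnalyticAt hp₁ hv).right.differentiableAt
  rw [hE.bracket p₁ hp₁ p₂ hp₂ v hv h12,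
    hh.fderiv_fderiv_eq hVo hf hl hp₂ hp₃ hv h23, hh.fderiv_fderiv_eq hVo hf hl hp₁ hp₃ hv h13,
    hh.fderiv_dp_eq hPo hf hl hp₁ hp₂ hv h12, hh.fderiv_dp_eq hPo hf hl hp₁ hp₃ hv h13,
    hh.fderiv_dp_eq hPo hf hl hp₂ hp₁ hv h12.symm, hh.fderiv_dp_eq hPo hf hl hp₂ hp₃ hv h23] at comm
  simp only [map_add, map_sub, map_smul, smul_eq_mul,
    hh.fderiv_eq hp₁ hp₃ hv h13, hh.fderiv_eq hp₂ hp₃ hv h23,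
    hh.fderiv_dp_g_eq hPo hg hf hl hp₁ hp₃ hv h13,
    hh.fderiv_dp_g_eq hPo hg hf hl hp₂ hp₃ hv h23] at comm
  have hj := hE.jacobi p₁ hp₁ p₂ hp₂ p₃ hp₃ v hv h12 h13 h23
  simp only [alongField] at hj
  simp only [GTData.lamDefect]
  linear_combination -comm - dp h p₃ v * hj

/-- Two potentials give a homogeneous linear system for the two defects whose determinant is, up to
sign, their `derivMinor` at `p₁, p₂`, generically non-zero. Continuity in `(p₁, p₂, v)` with `p₃`
fixed covers the other points. -/
theorem lam_eq_of_potentials (hPo : IsOpen P) (hPc : IsPreconnected P) (hVo : IsOpen V)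
    (hVc : IsPreconnected V) (hE : IsLocalGT P V E.g E.f)
    (hl : IsHolomorphicOffDiagonal P V E.lam) (hH : H ⊆ potentials P V E)
    (hN : Nondegenerate P V H) {p₁ p₂ p₃ : ℂ} {v : Fields m}
    (hp₁ : p₁ ∈ P) (hp₂ : p₂ ∈ P) (hp₃ : p₃ ∈ P) (hv : v ∈ V) (h12 : p₁ ≠ p₂) (h13 : p₁ ≠ p₃)
    (h23 : p₂ ≠ p₃) : E.lamDefect p₁ p₂ p₃ v = 0 := by
  obtain ⟨-, T, hT, v₀, hv₀, ζ, hζ, hdet⟩ := hN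
  obtain ⟨p₀, hp₀, w₀, hw₀, hD0⟩ := exists_derivMinor_ne_zero hζ hdet
  have hf := hE.holomorphic_f
  have hg := hE.holomorphic_g
  have hx : (p₁, p₂, v) ∈ P ×ˢ P ×ˢ V := ⟨hp₁, hp₂, hv⟩
  refine eq_zero_of_continuousAt_of_forall_ne_zero
    (derivMinor_analyticOnNhd (hH (hT 0)).1 (hH (hT 1)).1) (isPreconnected_triples hPc hVc)
    (x₀ := (p₀, w₀, v₀)) ⟨hp₀, hw₀, hv₀⟩ hD0 hx
    (G := fun x => E.lamDefect x.1 x.2.1 p₃ x.2.2) ?_ ?_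
  · have c12 : ∀ {φ}, JointAnalyticAt₂ φ p₁ p₂ v →
        ContinuousAt (fun x : ℂ × ℂ × Fields m => φ x.1 x.2.1 x.2.2) (p₁, p₂, v) := fun h =>
      AnalyticAt.continuousAt h
    have c21 : ∀ {φ}, JointAnalyticAt₂ φ p₂ p₁ v →
        ContinuousAt (fun x : ℂ × ℂ × Fields m => φ x.2.1 x.1 x.2.2) (p₁, p₂, v) := fun h =>
      ContinuousAt.comp (f := fun x : ℂ × ℂ × Fields m => (x.2.1, x.1, x.2.2)) (x := (p₁, p₂, v))
        (AnalyticAt.continuousAt h) (by fun_prop)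
    have c13 : ∀ {φ}, JointAnalyticAt₂ φ p₁ p₃ v →
        ContinuousAt (fun x : ℂ × ℂ × Fields m => φ x.1 p₃ x.2.2) (p₁, p₂, v) := fun h =>
      ContinuousAt.comp (f := fun x : ℂ × ℂ × Fields m => (x.1, p₃, x.2.2)) (x := (p₁, p₂, v))
        (AnalyticAt.continuousAt h) (by fun_prop)
    have c23 : ∀ {φ}, JointAnalyticAt₂ φ p₂ p₃ v →
        ContinuousAt (fun x : ℂ × ℂ × Fields m => φ x.2.1 p₃ x.2.2) (p₁, p₂, v) := fun h =>
      ContinuousAt.comp (f := fun x : ℂ × ℂ × Fields m => (x.2.1, p₃, x.2.2)) (x := (p₁, p₂, v))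
        (AnalyticAt.continuousAt h) (by fun_prop)
    have l23 := hl.jointAnalyticAt hp₂ hp₃ hv h23
    have l13 := hl.jointAnalyticAt hp₁ hp₃ hv h13
    have l21 := hl.jointAnalyticAt hp₂ hp₁ hv h12.symm
    have f12 := hf.jointAnalyticAt hp₁ hp₂ hv h12
    have f13 := hf.jointAnalyticAt hp₁ hp₃ hv h13
    have hd : ContinuousAt (fun x : ℂ × ℂ × Fields m => fderiv ℂ (E.lam x.2.1 p₃) x.2.2)
        (p₁, p₂, v) :=
      ContinuousAt.comp (f := fun x : ℂ × ℂ × Fields m => (x.2.1, p₃, x.2.2)) (x := (p₁, p₂, v))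
        (l23.fderiv_analyticAt.continuousAt) (by fun_prop)
    exact (hd.clm_apply (hg.jointAnalyticAt hp₁ hv).comp_first.continuousAt).sub
      (((((c13 l13).mul (c21 l21.dp₂)).sub ((c23 l23).mul (c12 f12.dp₂))).sub
        ((c12 f12).mul (c23 l23.dp₁))).sub ((c13 f13).mul (c23 l23.dp₂)))
  · have n12 : ∀ᶠ x : ℂ × ℂ × Fields m in 𝓝 (p₁, p₂, v), x.1 ≠ x.2.1 :=
      (isOpen_ne_fun (by fun_prop) (by fun_prop)).mem_nhds h12
    have n13 : ∀ᶠ x : ℂ × ℂ × Fields m in 𝓝 (p₁, p₂, v), x.1 ≠ p₃ :=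
      (isOpen_ne_fun (by fun_prop) (by fun_prop)).mem_nhds h13
    have n23 : ∀ᶠ x : ℂ × ℂ × Fields m in 𝓝 (p₁, p₂, v), x.2.1 ≠ p₃ :=
      (isOpen_ne_fun (by fun_prop) (by fun_prop)).mem_nhds h23
    filter_upwards [(isOpen_triples hPo hVo).mem_nhds hx, n12, n13, n23] with w hw w12 w13 w23 hne
    have a := (hH (hT 0)).lamDefect_mul_eq hPo hVo hE hl hw.1 hw.2.1 hp₃ hw.2.2 w12 w13 w23
    have b := (hH (hT 1)).lamDefect_mul_eq hPo hVo hE hl hw.1 hw.2.1 hp₃ hw.2.2 w12 w13 w23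
    refine mul_right_cancel₀ hne ?_
    simp only [derivMinor]
    linear_combination dp (T 1) w.1 w.2.2 * a - dp (T 0) w.1 w.2.2 * b

/-- An enhanced structure is determined by the coefficients `f`, `g` of its Gibbons–Tsarev system
and by sufficiently many potentials. -/
theorem IsAdmissible.eq_of_toSystem_eq (hPo : IsOpen P) {E' : GTData m}
    (hE : IsAdmissible P V E) (hE' : IsAdmissible P V E')
    (hf : (E.toSystem P V).f = (E'.toSystem P V).f) (hg : (E.toSystem P V).g = (E'.toSystem P V).g)
    (hH : H ⊆ potentials P V E) (hH' : H ⊆ potentials P V E')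
    (hN : ∀ p ∈ P, ∀ v ∈ V, ∃ h ∈ H, dp h p v ≠ 0) : E = E' := by
  -- As `f` has residue one, the residue of `f̂` is `1 / g_0`; the system therefore determines the
  -- scale.
  have residue : ∀ {E : GTData m}, IsAdmissible P V E →
      HasDiagonalResidue P V (E.toSystem P V).f (fun p v => (E.g p v 0)⁻¹) := by
    intro E hE
    obtain ⟨e, he, hfe, hee⟩ := hE.1.localGT.pole_f
    refine ⟨fun p₁ p₂ v => (E.g p₁ v 0)⁻¹ * e p₁ p₂ v, ?_, ?_, ?_⟩
    · rintro ⟨p₁, p₂, v⟩ hx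
      exact (AnalyticAt.inv (hE.jointAnalyticAt_scale hx.1 hx.2.2).comp_first
        (hE.2 _ hx.1 _ hx.2.2)).mul (he _ hx)
    · intro p₁ hp₁ p₂ hp₂ v hv hne
      rw [hE.toSystem_f, hfe p₁ hp₁ p₂ hp₂ v hv hne]
      ring
    · intro p hp v hv
      simp only [hee p hp v hv, mul_one]
  have hγ : ∀ p v, E.g p v 0 = E'.g p v 0 := by
    intro p v
    by_cases h : p ∈ P ∧ v ∈ V
    · have h1 := residue hE
      rw [hf] at h1
      exact inv_injective (h1.unique hPo (residue hE') h.1 h.2)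
    · rw [hE.1.localGT.holomorphic_g.zero_outside _ _ h,
        hE'.1.localGT.holomorphic_g.zero_outside _ _ h]
  have hfE : E.f = E'.f := by
    rw [hE.eq_rescale, hE'.eq_rescale]
    simp only [GTSystem.rescale, hf, hγ]
  have hgE : E.g = E'.g := by
    rw [hE.eq_rescale, hE'.eq_rescale]
    simp only [GTSystem.rescale, hg, hγ]
  have hlE : E.lam = E'.lam := by
    ext p₁ p₂ v
    by_cases h : (p₁, p₂, v) ∈ offDiagonal P V
    · obtain ⟨hp₁, hp₂, hv, hne⟩ := h
      obtain ⟨k, hk, hk0⟩ := hN p₁ hp₁ v hv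
      have a := (hH hk).fderiv_eq hp₁ hp₂ hv hne
      have b := (hH' hk).fderiv_eq hp₁ hp₂ hv hne
      rw [hgE, hfE] at a
      refine mul_right_cancel₀ hk0 ?_
      linear_combination b - a
    · rw [hE.1.holomorphic_lam.zero_outside _ _ _ h, hE'.1.holomorphic_lam.zero_outside _ _ _ h]
  exact GTData.ext hgE hfE hlE

/-- The equality of the `q`'s is the only one that is not a cancellation of `γ`: `IsScale` recovers
`q` on both sides from the same `f`, `g` and scale. -/
theorem IsGibbonsTsarev.toSystem_eq (hPo : IsOpen P) (hVo : IsOpen V) {S : GTSystem m}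
    {γ : ℂ → Fields m → ℂ} {lam : ℂ → ℂ → Fields m → ℂ} (hS : IsGibbonsTsarev P V S)
    (hγ : S.IsScale γ P V) (hE : IsAdmissible P V (S.rescale γ lam)) :
    (S.rescale γ lam).toSystem P V = S := by
  have hγ' : ∀ p ∈ P, ∀ v ∈ V, γ p v = (S.rescale γ lam).g p v 0 := by
    intro p hp v hv
    simp [GTSystem.rescale, hS.g_zero p hp v hv]
  have hf : ((S.rescale γ lam).toSystem P V).f = S.f := by
    ext p₁ p₂ v
    rw [hE.toSystem_f]
    by_cases h : (p₁, p₂, v) ∈ offDiagonal P V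
    · rw [← hγ' p₁ h.1 v h.2.2.1]
      exact mul_div_cancel_left₀ _ (hγ.ne_zero p₁ h.1 v h.2.2.1)
    · simp [GTSystem.rescale, hS.holomorphic_f.zero_outside _ _ _ h]
  have hg : ((S.rescale γ lam).toSystem P V).g = S.g := by
    ext p v : 2
    rw [hE.toSystem_g]
    by_cases h : p ∈ P ∧ v ∈ V
    · rw [← hγ' p h.1 v h.2]
      exact inv_smul_smul₀ (hγ.ne_zero p h.1 v h.2) _
    · simp [GTSystem.rescale, hS.holomorphic_g.zero_outside _ _ h]
  refine GTSystem.ext hf hg ?_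
  ext p₁ p₂ v
  by_cases h : (p₁, p₂, v) ∈ offDiagonal P V
  · obtain ⟨hp₁, hp₂, hv, hne⟩ := h
    rw [hE.isScale.q_eq p₁ hp₁ p₂ hp₂ v hv hne,
      (hγ.congr hPo hVo hγ').q_eq p₁ hp₁ p₂ hp₂ v hv hne, hf, hg]
  · rw [hS.holomorphic_q.zero_outside _ _ _ h,
      (hE.holomorphic_toSystem_q hPo hVo).zero_outside _ _ _ h]

/-- The scale is the inverse residue and `λ` is the factor of proportionality between `γ · lamNum`
and `h'(p)`, divided by `p - z`. -/
theorem IntegrableBy.exists_admissible (hPo : IsOpen P) (hPc : IsPreconnected P) (hVo : IsOpen V)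
    (hVc : IsPreconnected V) {S : GTSystem m} (hI : IntegrableBy P V S H)
    (hN : Nondegenerate P V H) :
    ∃ E : GTData m, IsAdmissible P V E ∧ E.toSystem P V = S ∧ H ⊆ potentials P V E := by
  classical
  have hS := hI.gibbonsTsarev
  obtain ⟨ρ, ⟨e, he, hf, hρ⟩, hρ0⟩ := hS.pole_f
  have h0 : ∀ p ∈ P, ∀ v ∈ V, e p p v ≠ 0 := fun p hp v hv => hρ p hp v hv ▸ hρ0 p hp v hv
  set γ : ℂ → Fields m → ℂ := fun p v => (e p p v)⁻¹ with hγdef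
  have hγ : S.IsScale γ P V := hS.isScale hPo hVo he hf h0
  -- The potential is chosen pointwise, with no regularity in `(p, v)`. By `l_eq` the quotient does
  -- not depend on it, so near each point one fixed potential may be used, whence analyticity.
  choose! κ hκ hκ0 using hN.1
  set l : ℂ → ℂ → Fields m → ℂ := fun p z v => γ p v * lamNum S e (κ p v) p z v / dp (κ p v) p v
    with hl
  have l_eq : ∀ {h p z v}, h ∈ H → p ∈ P → z ∈ P → v ∈ V → dp h p v ≠ 0 →
      l p z v = γ p v * lamNum S e h p z v / dp h p v := by
    intro h p z v hh hp hz hv hne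
    have := hI.lamNum_mul_eq hPo hPc hVo hVc hN he hf (hκ p hp v hv) hh (p, z, v) ⟨hp, hz, hv⟩
    rw [hl, div_eq_div_iff (hκ0 p hp v hv) hne, mul_assoc, this, mul_assoc]
  have l_an : AnalyticOnNhd ℂ (fun x : ℂ × ℂ × Fields m => l x.1 x.2.1 x.2.2) (P ×ˢ P ×ˢ V) := by
    rintro ⟨p, z, v⟩ hx
    have ⟨hp, hz, hv⟩ : p ∈ P ∧ z ∈ P ∧ v ∈ V := hx
    have hk := hI.holomorphic _ (hκ p hp v hv)
    have hc := (hk.jointAnalyticAt hp hv).dp.comp_first (p₂ := z)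
    refine AnalyticAt.congr (((hγ.analytic p hp v hv).comp_first.mul
      (lamNum_analyticAt hS.holomorphic_g hk hp hz hv (he _ hx))).div hc (hκ0 p hp v hv)) ?_
    filter_upwards [(isOpen_triples hPo hVo).mem_nhds hx,
      hc.continuousAt.eventually_ne (hκ0 p hp v hv)] with w hw hw0
    exact (l_eq (hκ p hp v hv) hw.1 hw.2.1 hw.2.2 hw0).symm
  set lam : ℂ → ℂ → Fields m → ℂ := fun p z v =>
    if (p, z, v) ∈ offDiagonal P V then l p z v / (p - z) else 0 with hlam
  have lam_pos : ∀ {p z v}, p ∈ P → z ∈ P → v ∈ V → p ≠ z → lam p z v = l p z v / (p - z) :=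
    fun hp hz hv hne => if_pos ⟨hp, hz, hv, hne⟩
  have lam_hol : IsHolomorphicOffDiagonal P V lam := by
    refine IsHolomorphicOffDiagonal.of_ite hPo hVo (φ := fun p z v => l p z v / (p - z))
      fun p hp z hz v hv hne => ?_
    have hd := (ContinuousLinearMap.fst ℂ ℂ (ℂ × Fields m) -
      (ContinuousLinearMap.fst ℂ ℂ (Fields m)).comp
      (ContinuousLinearMap.snd ℂ ℂ (ℂ × Fields m))).analyticAt (p, z, v)
    exact (l_an (p, z, v) ⟨hp, hz, hv⟩).div hd (sub_ne_zero.2 hne)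
  set E := S.rescale γ lam with hEdef
  have hGT : IsLocalGT P V E.g E.f := {
    holomorphic_g := {
      analytic := fun x hx => AnalyticAt.smul (hγ.analytic _ hx.1 _ hx.2)
        (hS.holomorphic_g.analytic x hx)
      zero_outside := fun p v h => by
        simp [hEdef, GTSystem.rescale, hS.holomorphic_g.zero_outside p v h] }
    holomorphic_f := {
      analytic := fun x hx => AnalyticAt.mul (hγ.analytic _ hx.1 _ hx.2.2.1).comp_first
        (hS.holomorphic_f.analytic x hx)
      zero_outside := fun p₁ p₂ v h => by
        simp [hEdef, GTSystem.rescale, hS.holomorphic_f.zero_outside p₁ p₂ v h] }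
    bracket := fun p₁ hp₁ p₂ hp₂ v hv hne =>
      (hγ.bracket_iff hS.holomorphic_f hS.holomorphic_g hp₁ hp₂ hv hne hEdef).2
        (hS.compatible.mixedFields_symm hS.holomorphic_g hp₁ hp₂ hv hne)
    jacobi := fun p₁ hp₁ p₂ hp₂ p₃ hp₃ v hv h12 h13 h23 =>
      (hγ.jacobi_iff hS.holomorphic_f hp₁ hp₂ hp₃ hv h12 h13 h23 hEdef).2
        (hS.compatible.mixedPoint_symm hS.holomorphic_f hp₁ hp₂ hp₃ hv h12 h13 h23)
    pole_f := by
      refine ⟨fun p₁ p₂ v => γ p₁ v * e p₁ p₂ v, ?_, ?_, ?_⟩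
      · intro x hx
        exact AnalyticAt.mul (hγ.analytic _ hx.1 _ hx.2.2).comp_first (he x hx)
      · intro p₁ hp₁ p₂ hp₂ v hv hne
        simp only [hEdef, GTSystem.rescale, hf p₁ hp₁ p₂ hp₂ v hv hne, mul_div_assoc]
      · intro p hp v hv
        exact inv_mul_cancel₀ (h0 p hp v hv) }
  have hpot : H ⊆ potentials P V E := by
    intro h hh
    refine ⟨hI.holomorphic h hh, fun p hp z hz v hv hne => ?_⟩
    have n : p - z ≠ 0 := sub_ne_zero.2 hne
    have hprop := hI.lamNum_mul_eq hPo hPc hVo hVc hN he hf (hκ p hp v hv) hh (p, z, v)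
      ⟨hp, hz, hv⟩
    have nk := hκ0 p hp v hv
    simp only [alongField, hEdef, GTSystem.rescale, map_smul, smul_eq_mul,
      lam_pos hp hz hv hne, hl, hf p hp z hz v hv hne]
    have hnum : lamNum S e h p z v =
        (p - z) * fderiv ℂ (h z) v (S.g p v) + e p z v * dp h z v := rfl
    field_simp
    simp only at hprop
    linear_combination γ p v * (-dp (κ p v) p v * hnum - hprop)
  have hE : IsAdmissible P V E := by
    refine ⟨⟨hGT, lam_hol, ?_, l, l_an, fun p hp z hz v hv hne => lam_pos hp hz hv hne, ?_⟩, ?_⟩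
    · intro p₁ hp₁ p₂ hp₂ p₃ hp₃ v hv h12 h13 h23
      exact sub_eq_zero.1
        (lam_eq_of_potentials hPo hPc hVo hVc hGT lam_hol hpot hN hp₁ hp₂ hp₃ hv h12 h13 h23)
    -- On the diagonal `lamNum` reduces to `e(p, p) h'(p)`, so `l = γ e = 1`.
    · intro p hp v hv
      have nk := hκ0 p hp v hv
      have ne := h0 p hp v hv
      simp only [hl, lamNum, hγdef]
      field_simp
      ring
    · intro p hp v hv
      simp [hEdef, GTSystem.rescale, hS.g_zero p hp v hv, hγ.ne_zero p hp v hv]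
  exact ⟨E, hE, hS.toSystem_eq hPo hVo hγ hE, hpot⟩

end Potentials

/-! ### Uniqueness from the potentials alone and the bijections. -/

section Correspondence

variable {m : ℕ} {P : Set ℂ} {V : Set (Fields m)} {H : Set (ℂ → Fields m → ℂ)}

theorem Nondegenerate.mono {H' : Set (ℂ → Fields m → ℂ)} (h : Nondegenerate P V H)
    (hH : H ⊆ H') : Nondegenerate P V H' := by
  obtain ⟨h1, T, hT, h2⟩ := h
  exact ⟨fun p hp v hv => (h1 p hp v hv).imp fun k hk => ⟨hH hk.1, hk.2⟩, T,
    fun a => hH (hT a), h2⟩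

theorem IntegrableBy.existsUnique_admissible (hPo : IsOpen P) (hPc : IsPreconnected P)
    (hVo : IsOpen V) (hVc : IsPreconnected V) {S : GTSystem m} (hI : IntegrableBy P V S H)
    (hN : Nondegenerate P V H) :
    ∃! E : GTData m, IsAdmissible P V E ∧ E.toSystem P V = S ∧ H ⊆ potentials P V E := by
  obtain ⟨E, hE, hES, hEH⟩ := hI.exists_admissible hPo hPc hVo hVc hN
  refine ⟨E, ⟨hE, hES, hEH⟩, fun E' ⟨hE', hES', hEH'⟩ => ?_⟩
  have h := hES'.trans hES.symm
  exact hE'.eq_of_toSystem_eq hPo hE (congrArg GTSystem.f h) (congrArg GTSystem.g h)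
    hEH' hEH hN.1

/-- If the characteristics are simple, the potentials alone determine the enhanced structure. -/
theorem IsAdmissible.eq_of_simpleCharacteristics (hPo : IsOpen P) (hPc : IsPreconnected P)
    (hVo : IsOpen V) (hVc : IsPreconnected V) {E E' : GTData m}
    (hE : IsAdmissible P V E) (hE' : IsAdmissible P V E') (hH : H ⊆ potentials P V E)
    (hH' : H ⊆ potentials P V E') (hN : Nondegenerate P V H)
    (hC : HasSimpleCharacteristics P V H) : E = E' := by
  obtain ⟨W, hWo, ⟨w, hw⟩, hWPV, hW⟩ := hC
  -- Both `g(p)` are characteristic directions, hence proportional on `W`. The cross-multiplied form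
  -- is analytic and so extends to `P × V`.
  have hgW : ∀ x ∈ W, ∀ l, E.g x.1 x.2 l * E'.g x.1 x.2 0 = E'.g x.1 x.2 l * E.g x.1 x.2 0 := by
    intro x hx l
    obtain ⟨hp, hv⟩ := hWPV hx
    obtain ⟨μ, hμ⟩ := hW x hx (E.g x.1 x.2) (E'.g x.1 x.2)
      (isCharacteristic_of_subset_potentials hPo hH hp hv)
      (isCharacteristic_of_subset_potentials hPo hH' hp hv)
      (fun h => hE.2 x.1 hp x.2 hv (by rw [h]; rfl))
    rw [hμ]
    simp only [Pi.smul_apply, smul_eq_mul]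
    ring
  have hgE := hE.1.localGT.holomorphic_g
  have hgE' := hE'.1.localGT.holomorphic_g
  have hgPV : ∀ x ∈ P ×ˢ V, ∀ l,
      E.g x.1 x.2 l * E'.g x.1 x.2 0 = E'.g x.1 x.2 l * E.g x.1 x.2 0 := by
    intro x hx l
    have han : AnalyticOnNhd ℂ (fun x : ℂ × Fields m =>
        E.g x.1 x.2 l * E'.g x.1 x.2 0 - E'.g x.1 x.2 l * E.g x.1 x.2 0) (P ×ˢ V) := fun y hy =>
      (AnalyticAt.mul ((hgE.jointAnalyticAt hy.1 hy.2).component l)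
        ((hgE'.jointAnalyticAt hy.1 hy.2).component 0)).sub
      (AnalyticAt.mul ((hgE'.jointAnalyticAt hy.1 hy.2).component l)
        ((hgE.jointAnalyticAt hy.1 hy.2).component 0))
    refine sub_eq_zero.1 (han.eqOn_zero_of_preconnected_of_eventuallyEq_zero (hPc.prod hVc)
      (hWPV hw) ?_ hx)
    filter_upwards [hWo.mem_nhds hw] with y hy
    exact sub_eq_zero.2 (hgW y hy l)
  have hg : (E.toSystem P V).g = (E'.toSystem P V).g := by
    ext p v l
    rw [hE.toSystem_g, hE'.toSystem_g, Pi.smul_apply, Pi.smul_apply, smul_eq_mul, smul_eq_mul]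
    by_cases h : p ∈ P ∧ v ∈ V
    · have n := hE.2 p h.1 v h.2
      have n' := hE'.2 p h.1 v h.2
      have := hgPV (p, v) h l
      field_simp
      linear_combination this
    · simp [hgE.zero_outside _ _ h, hgE'.zero_outside _ _ h]
  have hf : (E.toSystem P V).f = (E'.toSystem P V).f := by
    have hfE := hE.holomorphic_toSystem_f hPo hVo
    have hfE' := hE'.holomorphic_toSystem_f hPo hVo
    ext p z v
    by_cases h : (p, z, v) ∈ offDiagonal P V
    · obtain ⟨-, T, hT, v₀, hv₀, ζ, hζ, hdet⟩ := hN
      obtain ⟨p₀, hp₀, w₀, hw₀, hD0⟩ := exists_derivMinor_ne_zero hζ hdet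
      rw [← sub_eq_zero]
      refine eq_zero_of_continuousAt_of_forall_ne_zero
        (derivMinor_analyticOnNhd (hH (hT 0)).1 (hH (hT 1)).1) (isPreconnected_triples hPc hVc)
        (x₀ := (p₀, w₀, v₀)) ⟨hp₀, hw₀, hv₀⟩ hD0 (x := (p, z, v)) ⟨h.1, h.2.1, h.2.2.1⟩
        (G := fun x => (E.toSystem P V).f x.1 x.2.1 x.2.2 - (E'.toSystem P V).f x.1 x.2.1 x.2.2)
        ((hfE.analytic _ h).continuousAt.sub (hfE'.analytic _ h).continuousAt) ?_
      filter_upwards [(isOpen_offDiagonal hPo hVo).mem_nhds h] with x hx hne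
      obtain ⟨hp, hz, hv, hpz⟩ := hx
      -- With `ĝ` now common to both structures, the difference of the normalized functional
      -- equations is a relation between `k'(p)` and `k'(z)` alone. Two potentials with non-zero
      -- minor make its coefficients vanish.
      have key : ∀ k ∈ H, (E.lam x.1 x.2.1 x.2.2 / E.g x.1 x.2.2 0
            - E'.lam x.1 x.2.1 x.2.2 / E'.g x.1 x.2.2 0) * dp k x.1 x.2.2 =
          ((E.toSystem P V).f x.1 x.2.1 x.2.2 - (E'.toSystem P V).f x.1 x.2.1 x.2.2)
            * dp k x.2.1 x.2.2 := by
        intro k hk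
        have a := (hH hk).fderiv_eq hp hz hv hpz
        have b := (hH' hk).fderiv_eq hp hz hv hpz
        have c := congrArg (fderiv ℂ (k x.2.1) x.2.2) (congrFun₂ hg x.1 x.2.2)
        rw [hE.toSystem_g, hE'.toSystem_g, map_smul, map_smul, a, b, smul_eq_mul, smul_eq_mul] at c
        rw [hE.toSystem_f, hE'.toSystem_f]
        simp only [div_eq_mul_inv]
        linear_combination c
      refine mul_right_cancel₀ hne ?_
      simp only [derivMinor]
      linear_combination dp (T 1) x.1 x.2.2 * (-key _ (hT 0)) + dp (T 0) x.1 x.2.2 * key _ (hT 1)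
    · rw [hfE.zero_outside _ _ _ h, hfE'.zero_outside _ _ _ h]
  exact hE.eq_of_toSystem_eq hPo hE' hf hg hH hH' hN.1

end Correspondence

theorem proposition6p2 {m : ℕ} (P : Set ℂ) (V : Set (Fields m))
    (hPo : IsOpen P) (hPc : IsConnected P) (hVo : IsOpen V) (hVc : IsConnected V) :
    -- every family of solutions of the functional equation is an integrable hierarchy
    (∀ E : GTData m, IsAdmissible P V E →
      ∀ H : Set (ℂ → Fields m → ℂ), H ⊆ potentials P V E →
        IntegrableBy P V (E.toSystem P V) H) ∧
    -- every non-degenerate integrable hierarchy comes from exactly one enhanced structure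
    (∀ (S : GTSystem m) (H : Set (ℂ → Fields m → ℂ)),
      IntegrableBy P V S H → Nondegenerate P V H →
        ∃! E : GTData m, IsAdmissible P V E ∧ E.toSystem P V = S ∧ H ⊆ potentials P V E) ∧
    -- the correspondence, hierarchies being taken with their Gibbons-Tsarev system
    Set.BijOn (fun E : GTData m => (E.toSystem P V, potentials P V E))
      {E | IsAdmissible P V E ∧ Nondegenerate P V (potentials P V E)}
      {SH | Maximal (IntegrableBy P V SH.1) SH.2 ∧ Nondegenerate P V SH.2} ∧
    -- the correspondence, hierarchies being taken as sets of potentials alone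
    Set.BijOn (fun E : GTData m => potentials P V E)
      {E | IsAdmissible P V E ∧ Nondegenerate P V (potentials P V E) ∧
        HasSimpleCharacteristics P V (potentials P V E)}
      {H | Maximal (IntegrableByReductions P V) H ∧ Nondegenerate P V H ∧
        HasSimpleCharacteristics P V H} := by
  have hPc' := hPc.isPreconnected
  have hVc' := hVc.isPreconnected
  have unique : ∀ (S : GTSystem m) (H : Set (ℂ → Fields m → ℂ)),
      IntegrableBy P V S H → Nondegenerate P V H →
        ∃! E : GTData m, IsAdmissible P V E ∧ E.toSystem P V = S ∧ H ⊆ potentials P V E :=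
    fun S H hI hN => hI.existsUnique_admissible hPo hPc' hVo hVc' hN
  have forward : ∀ {E : GTData m}, IsAdmissible P V E →
      IntegrableBy P V (E.toSystem P V) (potentials P V E) := fun hE =>
    hE.integrableBy hPo hVo subset_rfl
  refine ⟨fun E hE H hH => hE.integrableBy hPo hVo hH, unique, ⟨?_, ?_, ?_⟩, ⟨?_, ?_, ?_⟩⟩
  · rintro E ⟨hE, hN⟩
    refine ⟨⟨forward hE, fun H' hI' hle => ?_⟩, hN⟩
    -- The structure of the larger hierarchy also contains all potentials of `E` and has the same
    -- system, so uniqueness identifies it with `E`.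
    obtain ⟨E', ⟨hE', hS, hH'⟩, -⟩ := unique _ _ hI' (hN.mono hle)
    have : E' = E := (unique _ _ (forward hE) hN).unique ⟨hE', hS, hle.trans hH'⟩
      ⟨hE, rfl, subset_rfl⟩
    exact this ▸ hH'
  · rintro E ⟨hE, hN⟩ E' ⟨hE', -⟩ heq
    obtain ⟨hS, hH⟩ := Prod.ext_iff.1 heq
    exact (unique _ _ (forward hE) hN).unique ⟨hE, rfl, subset_rfl⟩ ⟨hE', hS.symm, hH.le⟩
  · rintro ⟨S, H⟩ ⟨⟨hI, hmax⟩, hN⟩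
    obtain ⟨E, ⟨hE, hS, hH⟩, -⟩ := unique S H hI hN
    -- The potentials of `E` form an integrable hierarchy containing `H`, so maximality gives
    -- equality.
    have hpot : potentials P V E = H := (hmax (hS ▸ forward hE) hH).antisymm hH
    exact ⟨E, ⟨hE, hpot.symm ▸ hN⟩, Prod.ext hS hpot⟩
  · rintro E ⟨hE, hN, hC⟩
    refine ⟨⟨⟨_, forward hE⟩, ?_⟩, hN, hC⟩
    rintro H' ⟨S', hI'⟩ hle
    obtain ⟨E', ⟨hE', -, hH'⟩, -⟩ := unique _ _ hI' (hN.mono hle)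
    -- The larger hierarchy may use another system `S'`; simple characteristics of the potentials of
    -- `E` replace the equality of systems.
    have : E = E' := hE.eq_of_simpleCharacteristics hPo hPc' hVo hVc' hE' subset_rfl
      (hle.trans hH') hN hC
    exact this ▸ hH'
  · rintro E ⟨hE, hN, hC⟩ E' ⟨hE', -⟩ heq
    exact hE.eq_of_simpleCharacteristics hPo hPc' hVo hVc' hE' subset_rfl
      (le_of_eq heq) hN hC
  · rintro H ⟨⟨⟨S, hI⟩, hmax⟩, hN, hC⟩
    obtain ⟨E, ⟨hE, -, hH⟩, -⟩ := unique S H hI hN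
    have hpot : potentials P V E = H := (hmax ⟨_, forward hE⟩ hH).antisymm hH
    exact ⟨E, ⟨hE, hpot.symm ▸ hN, hpot.symm ▸ hC⟩, hpot⟩
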